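/- **Setting.** Let $p,q\ge 0$ be integers, let $K\subset\mathbb R^d$ be compact, $\theta_0\in K$, and let $(Z_t)_{t\in\mathbb Z}$ be i.i.d. real random variables on a probability space with $\mathbb E Z_0=0$, $\mathbb E Z_0^2=1$; put $\mathcal F_t=\sigma(Z_k;\,k\le t)$. Let $\{g_\theta:\theta\in K\}$ be a family of functions $g_\theta:\mathbb R^p\times[0,\infty)^q\to[0,\infty)$ such that $x\mapsto g_\theta(x,s)$ is Borel measurable for all $\theta,s$. A solution of the model (with parameter $\theta_0$) is a process $((X_t,\sigma_t))_{t\in\mathbb Z}$ with $\sigma_t\ge 0$, $\sigma_t$ being $\mathcal F_{t-1}$-measurable, and almost surely, for all $t\in\mathbb Z$, $$X_t=\sigma_tZ_t,\qquad \sigma_t^2=g_{\theta_0}(\mathbf X_{t-1},\boldsymbol\sigma_{t-1}^2),$$ where $\mathbf X_t=(X_t,\dots,X_{t-p+1})^T$ and $\boldsymbol\sigma_t^2=(\sigma_t^2,\dots,\sigma_{t-q+1}^2)^T$. Let $\mathbb C(K,[0,\infty)^q)$ be the space of continuous functions $K\to[0,\infty)^q$ with the metric $\|u-v\|_K$, where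 $\|v\|_K=\sup_{\theta\in K}|v(\theta)|$ and $|\cdot|$ is the Euclidean norm, and with its Borel $\sigma$-field. For a self-map $\phi$ of this space put $\Lambda(\phi)=\sup_{u\ne v}\|\phi(u)-\phi(v)\|_K/\|u-v\|_K\in[0,\infty]$. Define the random maps $\Phi_t$ ($t\in\mathbb Z$) by $$[\Phi_t(\mathbf s)](\theta)=\bigl(g_\theta(\mathbf X_t,\mathbf s(\theta)),s_1(\theta),\dots,s_{q-1}(\theta)\bigr)^T,\qquad \theta\in K$$ (for $q=0$ all vectors of length $q$ are empty), and $\Phi_t^{(r)}=\Phi_t\circ\Phi_{t-1}\circ\cdots\circ\Phi_{t-r+1}$ for $r\ge1$. For $\varsigma\in[0,\infty)^q$ let $\hat{\mathbf h}_0\equiv\varsigma$ (a constant function on $K$) and $\hat{\mathbf h}_t=\Phi_{t-1}(\hat{\mathbf h}_{t-1})$ for $t\ge1$. A sequence is called stationary ergodic if its law on path space is invariant under the time shift and the shift is ergodic for this law. **Proposition 3.12.** Assume that the model with parameter $\theta_0$ has a unique stationary ergodic solution $((X_t,\sigma_t))$ and that $(\theta,s)\mapsto g_\theta(x,s)$ is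 continuous on $K\times[0,\infty)^q$ for every $x\in\mathbb R^p$. Then $(\Phi_t)_{t\in\mathbb Z}$ is a stationary ergodic sequence of random maps $\mathbb C(K,[0,\infty)^q)\to\mathbb C(K,[0,\infty)^q)$ (with respect to the $\sigma$-field generated by the evaluations $\phi\mapsto\phi(\mathbf s)$). Let $\varsigma\in[0,\infty)^q$ and suppose moreover that 1. $\mathbb E[\log^+\|\Phi_0(\varsigma)\|_K]<\infty$; 2. $\mathbb E[\log^+\Lambda(\Phi_0)]<\infty$, and there is an integer $r\ge1$ such that $\mathbb E[\log\Lambda(\Phi_0^{(r)})]<0$ (the value $-\infty$ being allowed). Then the stochastic recurrence equation $\mathbf s_{t+1}=\Phi_t(\mathbf s_t)$, $t\in\mathbb Z$, has a stationary solution $(\mathbf h_t)_{t\in\mathbb Z}$, which is unique (up to almost sure equality) among all stationary solutions, and it is ergodic. For every $t\in\mathbb Z$, $\mathbf h_t$ is $\mathcal F_{t-1}$-measurable (after modification on a null set) and $\mathbf h_t(\theta_0)=\boldsymbol\sigma_t^2$ almost surely. Moreover, $\|\hat{\mathbf h}_t-\mathbf h_t\|_K\to0$ exponentially fast almost surely: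 there is a constant $\gamma>1$ with $\gamma^t\|\hat{\mathbf h}_t-\mathbf h_t\|_K\to0$ almost surely as $t\to\infty$. -/

import Mathlib

open MeasureTheory ProbabilityTheory Filter Topology TopologicalSpace
open scoped NNReal ENNReal

noncomputable section

namespace CondHet

/-! ### Stationary ergodic sequences, exponentially fast almost sure convergence -/

section Sequences

variable {Ω : Type*} [MeasurableSpace Ω]

/-- The time shift on the path space `E^ℤ`. -/
def shift {E : Type*} (v : ℤ → E) : ℤ → E := fun t => v (t + 1)

/-- The sequence `(v_t)_{t ∈ ℤ}` of random elements of `E` is (strictly) stationary: its law on the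
path space `E^ℤ` (with the product σ-field) is invariant under the time shift. -/
def IsStationary {E : Type*} [MeasurableSpace E] (P : Measure Ω) (v : ℤ → Ω → E) : Prop :=
  (∀ t, Measurable (v t)) ∧
    MeasurePreserving (shift (E := E)) (P.map fun ω t => v t ω) (P.map fun ω t => v t ω)

/-- The sequence `(v_t)_{t ∈ ℤ}` is stationary and ergodic: the time shift preserves its law on the
path space and is ergodic for it. -/
def IsStationaryErgodic {E : Type*} [MeasurableSpace E] (P : Measure Ω) (v : ℤ → Ω → E) : Prop :=
  (∀ t, Measurable (v t)) ∧ Ergodic (shift (E := E)) (P.map fun ω t => v t ω)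

/-- `v_t → 0` exponentially fast almost surely as `t → ∞`. -/
def TendstoZeroEAS {B : Type*} [NormedAddCommGroup B] (P : Measure Ω) (v : ℕ → Ω → B) : Prop :=
  ∃ γ : ℝ, 1 < γ ∧ ∀ᵐ ω ∂P, Tendsto (fun t : ℕ => γ ^ t * ‖v t ω‖) atTop (𝓝 0)

end Sequences

/-! ### Lipschitz coefficients, iterates, logarithmic moments -/

/-- `Λ(φ) = sup_{x ≠ y} d(φ x, φ y) / d(x, y)`, with values in `[0, ∞]`. -/
def lipCoeff {E : Type*} [MetricSpace E] (φ : E → E) : ℝ≥0∞ :=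
  ⨆ (x : E) (y : E) (_ : x ≠ y), edist (φ x) (φ y) / edist x y

/-- The iterates `φ_t^{(0)} = id`, `φ_t^{(r)} = φ_t ∘ φ_{t-1} ∘ ⋯ ∘ φ_{t-r+1}`. -/
def pastIterate {E : Type*} (φ : ℤ → E → E) (t : ℤ) : ℕ → E → E
  | 0 => id
  | r + 1 => pastIterate φ t r ∘ φ (t - r)

/-- Positive part of the logarithm, `log⁺ a`, for `a ∈ [0, ∞]`. -/
def logPos (a : ℝ≥0∞) : ℝ≥0∞ := (ENNReal.log a).toENNReal

/-- Negative part of the logarithm, `log⁻ a = (-log a)⁺`, for `a ∈ [0, ∞]`; `log⁻ 0 = ∞`. -/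
def logNeg (a : ℝ≥0∞) : ℝ≥0∞ := (-ENNReal.log a).toENNReal

/-- `E[log⁺ Y] < ∞`. -/
def FiniteLogPosMoment {Ω : Type*} [MeasurableSpace Ω] (P : Measure Ω) (Y : Ω → ℝ≥0∞) : Prop :=
  ∫⁻ ω, logPos (Y ω) ∂P < ∞

/-- `E[log Y] < 0`, where the expectation `E[log Y] = E[log⁺ Y] - E[log⁻ Y]` exists in `[-∞, ∞)`.
The strict inequality below forces `E[log⁺ Y] < ∞`; the value `-∞` is allowed. -/
def NegativeLogMean {Ω : Type*} [MeasurableSpace Ω] (P : Measure Ω) (Y : Ω → ℝ≥0∞) : Prop :=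
  ∫⁻ ω, logPos (Y ω) ∂P < ∫⁻ ω, logNeg (Y ω) ∂P

/-! ### The state spaces `[0, ∞)^q` and `C(K, [0, ∞)^q)` -/

/-- The orthant `[0, ∞)^q` with the Euclidean metric. -/
abbrev Orthant (q : ℕ) : Type := PiLp 2 (fun _ : Fin q => ℝ≥0)

/-- The space `C(K, [0, ∞)^q)` of continuous functions on a compact `K ⊂ ℝ^d`; its metric is the
supremum over `K` of the Euclidean distance. -/
abbrev VolFun {d : ℕ} (K : Compacts (EuclideanSpace ℝ (Fin d))) (q : ℕ) : Type := C(K, Orthant q)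

section VolFun

variable {d : ℕ} {K : Compacts (EuclideanSpace ℝ (Fin d))} {q : ℕ}

instance : MeasurableSpace (VolFun K q) := borel _

instance : BorelSpace (VolFun K q) := ⟨rfl⟩

/-- The inclusion of `C(K, [0, ∞)^q)` into the Banach space `C(K, ℝ^q)` with the norm
`‖v‖_K = sup_{θ ∈ K} |v(θ)|`. -/
def toVec (f : VolFun K q) : C(K, EuclideanSpace ℝ (Fin q)) where
  toFun θ := WithLp.toLp 2 fun i => ((f θ i : ℝ≥0) : ℝ)
  continuous_toFun := by fun_prop

theorem dist_eq_norm_toVec (f f' : VolFun K q) : dist f f' = ‖toVec f - toVec f'‖ := by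
  have key : ∀ θ : K, dist (f θ) (f' θ) = dist (toVec f θ) (toVec f' θ) := by
    intro θ
    rw [EuclideanSpace.dist_eq, PiLp.dist_eq_sum (by norm_num)]
    simp [toVec, NNReal.dist_eq, Real.dist_eq, Real.sqrt_eq_rpow]
  rw [← dist_eq_norm]
  apply le_antisymm
  · rw [ContinuousMap.dist_le dist_nonneg]
    intro θ
    rw [key]
    exact ContinuousMap.dist_apply_le_dist θ
  · rw [ContinuousMap.dist_le dist_nonneg]
    intro θ
    rw [← key]
    exact ContinuousMap.dist_apply_le_dist θ

end VolFun

/-! ### The model -/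

section Model

variable {Ω : Type*}

/-- `F_t = σ(Z_k ; k ≤ t)`. -/
@[reducible] def past (Z : ℤ → Ω → ℝ) (t : ℤ) : MeasurableSpace Ω :=
  ⨆ k : ℤ, ⨆ _ : k ≤ t, MeasurableSpace.comap (Z k) inferInstance

/-- The vector `(X_t, …, X_{t-p+1})`. -/
def obsVec (p : ℕ) (X : ℤ → Ω → ℝ) (t : ℤ) (ω : Ω) : Fin p → ℝ := fun i => X (t - (i : ℕ)) ω

/-- The vector `(σ_t², …, σ_{t-q+1}²)`. -/
def volVec (q : ℕ) (σ : ℤ → Ω → ℝ≥0) (t : ℤ) (ω : Ω) : Orthant q :=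
  WithLp.toLp 2 fun j => σ (t - (j : ℕ)) ω ^ 2

variable [MeasurableSpace Ω]

/-- `(Z_t)` is an i.i.d. sequence of random variables with mean zero and unit second moment. -/
structure IsInnovation (P : Measure Ω) (Z : ℤ → Ω → ℝ) : Prop where
  measurable : ∀ t, Measurable (Z t)
  indep : iIndepFun Z P
  ident : ∀ t, IdentDistrib (Z t) (Z 0) P P
  mean : ∫ ω, Z 0 ω ∂P = 0
  second_moment : ∫ ω, Z 0 ω ^ 2 ∂P = 1

/-- `((X_t, σ_t))` solves, for the volatility function `g`, the model equations
`X_t = σ_t Z_t`, `σ_t² = g(X_{t-1}, …, X_{t-p}; σ_{t-1}², …, σ_{t-q}²)`, almost surely for every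
`t ∈ ℤ`, where `σ_t ≥ 0` is `F_{t-1}`-measurable. -/
structure IsModelSolution (P : Measure Ω) (Z : ℤ → Ω → ℝ) {p q : ℕ}
    (g : (Fin p → ℝ) → Orthant q → ℝ≥0) (X : ℤ → Ω → ℝ) (σ : ℤ → Ω → ℝ≥0) : Prop where
  measurable_obs : ∀ t, Measurable (X t)
  adapted : ∀ t, Measurable[past Z (t - 1)] (σ t)
  obs_eq : ∀ t, ∀ᵐ ω ∂P, X t ω = σ t ω * Z t ω
  vol_eq : ∀ t, ∀ᵐ ω ∂P, σ t ω ^ 2 = g (obsVec p X (t - 1) ω) (volVec q σ (t - 1) ω)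

/-- `((X_t, σ_t))` is a stationary ergodic solution of the model, and any other such solution
agrees with it almost surely. -/
structure IsUniqueStationaryErgodicSolution (P : Measure Ω) (Z : ℤ → Ω → ℝ) {p q : ℕ}
    (g : (Fin p → ℝ) → Orthant q → ℝ≥0) (X : ℤ → Ω → ℝ) (σ : ℤ → Ω → ℝ≥0) : Prop where
  solution : IsModelSolution P Z g X σ
  stationary_ergodic : IsStationaryErgodic P fun t ω => (X t ω, σ t ω)
  unique : ∀ (X' : ℤ → Ω → ℝ) (σ' : ℤ → Ω → ℝ≥0), IsModelSolution P Z g X' σ' →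
    IsStationaryErgodic P (fun t ω => (X' t ω, σ' t ω)) →
      ∀ t, ∀ᵐ ω ∂P, X' t ω = X t ω ∧ σ' t ω = σ t ω

end Model

/-! ### The random maps `Φ_t`, the recursion for `ĥ_t` and the stochastic recurrence equation -/

section SRE

variable {d : ℕ} {K : Compacts (EuclideanSpace ℝ (Fin d))} {p q : ℕ}

/-- The vector `(a, s_1, …, s_{q-1})`. -/
def consShift (a : ℝ≥0) (s : Orthant q) : Orthant q :=
  WithLp.toLp 2 fun i : Fin q =>
    if (i : ℕ) = 0 then a else s ⟨(i : ℕ) - 1, (Nat.sub_le _ _).trans_lt i.isLt⟩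

theorem continuous_consShift {T : Type*} [TopologicalSpace T] {a : T → ℝ≥0} {s : T → Orthant q}
    (ha : Continuous a) (hs : Continuous s) : Continuous fun τ => consShift (a τ) (s τ) := by
  refine (PiLp.continuous_toLp 2 _).comp (continuous_pi fun i => ?_)
  by_cases hi : (i : ℕ) = 0
  · simpa [hi] using ha
  · simp only [hi, if_false]
    fun_prop

/-- For `x ∈ ℝ^p`, the map `s ↦ (θ ↦ (g_θ(x, s(θ)), s_1(θ), …, s_{q-1}(θ)))` of `C(K, [0, ∞)^q)`
into itself. -/
def volMap (g : K → (Fin p → ℝ) → Orthant q → ℝ≥0)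
    (hg : ∀ x, Continuous fun y : K × Orthant q => g y.1 x y.2)
    (x : Fin p → ℝ) (s : VolFun K q) : VolFun K q where
  toFun θ := consShift (g θ x (s θ)) (s θ)
  continuous_toFun := continuous_consShift
    ((hg x).comp (continuous_id.prodMk s.continuous)) s.continuous

/-- The random maps `Φ_t`: `[Φ_t(s)](θ) = (g_θ(X_t, …, X_{t-p+1}, s(θ)), s_1(θ), …, s_{q-1}(θ))`. -/
def Phi {Ω : Type*} (g : K → (Fin p → ℝ) → Orthant q → ℝ≥0)
    (hg : ∀ x, Continuous fun y : K × Orthant q => g y.1 x y.2)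
    (X : ℤ → Ω → ℝ) (t : ℤ) (ω : Ω) : VolFun K q → VolFun K q :=
  volMap g hg (obsVec p X t ω)

/-- The recursion `ĥ_0 = ς` (a constant function on `K`), `ĥ_{t+1} = Φ_t(ĥ_t)` for `t ∈ ℕ`. -/
def hHat {Ω : Type*} (g : K → (Fin p → ℝ) → Orthant q → ℝ≥0)
    (hg : ∀ x, Continuous fun y : K × Orthant q => g y.1 x y.2)
    (X : ℤ → Ω → ℝ) (ς : Orthant q) : ℕ → Ω → VolFun K q
  | 0, _ => ContinuousMap.const K ς
  | t + 1, ω => Phi g hg X (t : ℤ) ω (hHat g hg X ς t ω)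

/-- `(h_t)_{t ∈ ℤ}` is a solution of the stochastic recurrence equation `s_{t+1} = Φ_t(s_t)`. -/
def IsSRESolution {Ω E : Type*} [MeasurableSpace Ω] (P : Measure Ω)
    (Φ : ℤ → Ω → E → E) (h : ℤ → Ω → E) : Prop :=
  ∀ t, ∀ᵐ ω ∂P, h (t + 1) ω = Φ t ω (h t ω)

end SRE

end CondHet

end

/-!
Read along the forward or the backward shift, the Lipschitz coefficients of the compositions
`Φ_t ∘ ⋯ ∘ Φ_{t-n+1}` form a submultiplicative cocycle over an ergodic system. Cutting a long
composition into blocks of length `r` and averaging over the `r` starting phases bounds it by a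
Birkhoff sum of `log Λ(Φ_0^{(r)})`, which has negative mean, so the cocycle decays like `ρ^n` with
`ρ < 1`. Since `log⁺ ‖Φ_0(ς)‖` is integrable, `‖Φ_{t-n}(ς)‖` grows subexponentially; hence
the backward iterates `Φ_{t-1} ∘ ⋯ ∘ Φ_{t-n}(ς)` are Cauchy, and their limit `h_t` is the stationary
ergodic solution. The forward decay gives the exponential rate for `ĥ_t`.

Two stationary solutions `u, v` satisfy `d(u_t, v_t) ≤ ρ^n d(u_{t-n}, v_{t-n})`, and the right-hand
side tends to zero in probability because the laws of `u_{t-n}` and `v_{t-n}` do not depend on `n`.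
The same argument for the recursion on `[0, ∞)^q` with `θ = θ₀`, which inherits the Lipschitz
bounds, compares `h_t(θ₀)` with `σ_t²`. For adaptedness, `X_t` is replaced by its version `σ_t Z_t`.
-/

namespace CondHet

section Ergodic

variable {α : Type*} (T : α → α) (f : α → ℝ)

/-- The running maxima `max (0, S_1, …, S_n)` of the Birkhoff sums `S_k` of `f` along `T`, in the
recursive form `M_{n+1} = max (0, f + M_n ∘ T)` on which the maximal inequality rests. -/
noncomputable def maxBirkhoff : ℕ → α → ℝ
  | 0, _ => 0
  | n + 1, x => max 0 (f x + maxBirkhoff n (T x))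

theorem maxBirkhoff_nonneg (n : ℕ) (x : α) : 0 ≤ maxBirkhoff T f n x := by
  cases n with
  | zero => exact le_rfl
  | succ n => exact le_max_left _ _

theorem maxBirkhoff_le_succ (n : ℕ) (x : α) :
    maxBirkhoff T f n x ≤ maxBirkhoff T f (n + 1) x := by
  induction n generalizing x with
  | zero => exact le_max_left _ _
  | succ n ih => exact max_le_max le_rfl (by gcongr; exact ih _)

theorem monotone_maxBirkhoff (x : α) : Monotone fun n => maxBirkhoff T f n x :=
  monotone_nat_of_le_succ fun n => maxBirkhoff_le_succ T f n x

theorem birkhoffSum_le_maxBirkhoff (n : ℕ) (x : α) :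
    birkhoffSum T f n x ≤ maxBirkhoff T f n x := by
  induction n generalizing x with
  | zero => simp [maxBirkhoff]
  | succ n ih =>
    rw [birkhoffSum_succ']
    exact le_max_of_le_right (by gcongr; exact ih _)

theorem max_neg_maxBirkhoff_comp (n : ℕ) (x : α) :
    max (-maxBirkhoff T f n (T x)) (f x) =
      maxBirkhoff T f (n + 1) x - maxBirkhoff T f n (T x) := by
  rw [maxBirkhoff, ← max_sub_sub_right, zero_sub, add_sub_cancel_right]

theorem bddAbove_maxBirkhoff_comp_iff (x : α) :
    BddAbove (Set.range fun n => maxBirkhoff T f n (T x)) ↔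
      BddAbove (Set.range fun n => maxBirkhoff T f n x) := by
  constructor
  · rintro ⟨C, hC⟩
    refine ⟨max 0 (f x + C), ?_⟩
    rintro _ ⟨n, rfl⟩
    cases n with
    | zero => exact le_max_left _ _
    | succ n => exact max_le_max le_rfl (by gcongr; exact hC ⟨n, rfl⟩)
  · rintro ⟨C, hC⟩
    refine ⟨C - f x, ?_⟩
    rintro _ ⟨n, rfl⟩
    exact le_sub_iff_add_le'.2 ((le_max_right _ _).trans (hC ⟨n + 1, rfl⟩))

variable {T f} [MeasurableSpace α] {μ : Measure α}

theorem measurable_maxBirkhoff (hT : Measurable T) (hf : Measurable f) (n : ℕ) :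
    Measurable (maxBirkhoff T f n) := by
  induction n with
  | zero => exact measurable_const
  | succ n ih => exact measurable_const.max (hf.add (ih.comp hT))

theorem integrable_maxBirkhoff (hT : MeasurePreserving T μ μ) (hf : Integrable f μ) (n : ℕ) :
    Integrable (maxBirkhoff T f n) μ := by
  induction n with
  | zero => exact integrable_zero _ _ _
  | succ n ih =>
    exact (integrable_zero _ _ _).sup (hf.add (hT.integrable_comp_of_integrable ih))

theorem integral_max_neg_maxBirkhoff_comp_nonneg (hT : MeasurePreserving T μ μ)
    (hf : Measurable f) (hfi : Integrable f μ) (n : ℕ) :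
    0 ≤ ∫ x, max (-maxBirkhoff T f n (T x)) (f x) ∂μ := by
  have hM := integrable_maxBirkhoff hT hfi
  have hMT : Integrable (fun x => maxBirkhoff T f n (T x)) μ :=
    hT.integrable_comp_of_integrable (hM n)
  have hinv : ∫ x, maxBirkhoff T f n (T x) ∂μ = ∫ x, maxBirkhoff T f n x ∂μ := by
    conv_rhs => rw [← hT.map_eq]
    exact (integral_map hT.measurable.aemeasurable
      (measurable_maxBirkhoff hT.measurable hf n).aestronglyMeasurable).symm
  simp_rw [max_neg_maxBirkhoff_comp]
  rw [integral_sub (hM _) hMT, hinv, sub_nonneg]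
  exact integral_mono (hM n) (hM _) (maxBirkhoff_le_succ T f n)

theorem tendsto_integral_max_neg_maxBirkhoff_comp (hT : Measurable T) (hf : Measurable f)
    (hfi : Integrable f μ)
    (hub : ∀ᵐ x ∂μ, ¬ BddAbove (Set.range fun n => maxBirkhoff T f n x)) :
    Tendsto (fun n => ∫ x, max (-maxBirkhoff T f n (T x)) (f x) ∂μ) atTop
      (𝓝 (∫ x, f x ∂μ)) := by
  refine tendsto_integral_of_dominated_convergence (fun x => |f x|) (fun n => ?_) hfi.abs
    (fun n => ?_) ?_
  · exact (((measurable_maxBirkhoff hT hf n).comp hT).neg.max hf).aestronglyMeasurable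
  · refine Eventually.of_forall fun x => ?_
    rw [Real.norm_eq_abs, abs_le]
    exact ⟨le_max_of_le_right (neg_abs_le _), max_le
      ((neg_nonpos.2 (maxBirkhoff_nonneg T f n _)).trans (abs_nonneg _)) (le_abs_self _)⟩
  · filter_upwards [hub] with x hx
    have hdiv : Tendsto (fun n => maxBirkhoff T f n (T x)) atTop atTop :=
      tendsto_atTop_atTop_of_monotone' (monotone_maxBirkhoff T f (T x))
        (mt (bddAbove_maxBirkhoff_comp_iff T f x).1 hx)
    refine tendsto_const_nhds.congr' ?_
    filter_upwards [hdiv.eventually_ge_atTop (-f x)] with n hn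
    exact (max_eq_right (neg_le.1 hn)).symm

theorem ae_bddAbove_birkhoffSum (hT : Ergodic T μ) (hf : Measurable f) (hfi : Integrable f μ)
    (hneg : ∫ x, f x ∂μ < 0) :
    ∀ᵐ x ∂μ, BddAbove (Set.range fun n => birkhoffSum T f n x) := by
  have hmeas : MeasurableSet {x | BddAbove (Set.range fun n => maxBirkhoff T f n x)} :=
    measurableSet_bddAbove_range (measurable_maxBirkhoff hT.measurable hf)
  rcases hT.toPreErgodic.ae_mem_or_ae_notMem hmeas
    (Set.ext (bddAbove_maxBirkhoff_comp_iff T f)) with hbdd | hunbdd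
  · filter_upwards [hbdd] with x hx
    exact hx.range_mono _ fun n => birkhoffSum_le_maxBirkhoff T f n x
  · exact absurd hneg (ge_of_tendsto'
      (tendsto_integral_max_neg_maxBirkhoff_comp hT.measurable hf hfi hunbdd)
      (integral_max_neg_maxBirkhoff_comp_nonneg hT.toMeasurePreserving hf hfi)).not_gt

variable [IsProbabilityMeasure μ]

theorem ae_eventually_birkhoffAverage_le (hT : Ergodic T μ) (hf : Measurable f)
    (hfi : Integrable f μ) {c : ℝ} (hc : ∫ x, f x ∂μ < c) :
    ∀ᵐ x ∂μ, ∀ᶠ n in atTop, birkhoffAverage ℝ T f n x ≤ c := by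
  obtain ⟨b, hfb, hbc⟩ := exists_between hc
  have hneg : ∫ x, (f x - b) ∂μ < 0 := by
    rw [integral_sub hfi (integrable_const b)]
    simpa using hfb
  filter_upwards [ae_bddAbove_birkhoffSum hT (hf.sub_const b) (hfi.sub (integrable_const b)) hneg]
    with x ⟨C, hC⟩
  have hlim : Tendsto (fun n : ℕ => C / n + b) atTop (𝓝 (0 + b)) :=
    (tendsto_const_div_atTop_nhds_zero_nat C).add_const b
  filter_upwards [hlim.eventually_le_const (by simpa using hbc), eventually_gt_atTop 0]
    with n hn hn0
  have hsum : birkhoffSum T f n x - n * b ≤ C := by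
    simpa [birkhoffSum, Finset.sum_sub_distrib] using hC ⟨n, rfl⟩
  refine le_trans ?_ hn
  have hn' : (0 : ℝ) < n := by exact_mod_cast hn0
  rw [birkhoffAverage, smul_eq_mul, inv_mul_le_iff₀ hn']
  field_simp
  linarith

theorem ae_tendsto_birkhoffAverage (hT : Ergodic T μ) (hf : Measurable f) (hfi : Integrable f μ) :
    ∀ᵐ x ∂μ, Tendsto (fun n => birkhoffAverage ℝ T f n x) atTop (𝓝 (∫ x, f x ∂μ)) := by
  have hup (k : ℕ) := ae_eventually_birkhoffAverage_le hT hf hfi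
    (c := ∫ x, f x ∂μ + 1 / (k + 1)) (lt_add_of_pos_right _ Nat.one_div_pos_of_nat)
  have hlow (k : ℕ) := ae_eventually_birkhoffAverage_le hT hf.neg hfi.neg
    (c := -∫ x, f x ∂μ + 1 / (k + 1)) (by
      rw [integral_neg']; exact lt_add_of_pos_right _ Nat.one_div_pos_of_nat)
  filter_upwards [ae_all_iff.2 hup, ae_all_iff.2 hlow] with x hx hx'
  refine Metric.tendsto_nhds.2 fun ε hε => ?_
  obtain ⟨k, hk⟩ := exists_nat_one_div_lt hε
  filter_upwards [hx k, hx' k] with n hn hn'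
  rw [birkhoffAverage_neg, Pi.neg_apply, Pi.neg_apply] at hn'
  rw [Real.dist_eq, abs_sub_lt_iff]
  constructor <;> linarith

theorem ae_tendsto_iterate_div_zero (hT : Ergodic T μ) (hf : Measurable f)
    (hfi : Integrable f μ) :
    ∀ᵐ x ∂μ, Tendsto (fun n : ℕ => f (T^[n] x) / n) atTop (𝓝 0) := by
  have hlim := ae_tendsto_birkhoffAverage hT hf hfi
  filter_upwards [hlim, hT.quasiMeasurePreserving.ae hlim] with x hx hTx
  have hdiff := (hTx.sub hx).add (tendsto_const_div_atTop_nhds_zero_nat (f x))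
  rw [sub_self, add_zero] at hdiff
  refine hdiff.congr fun n => ?_
  rw [birkhoffAverage_apply_sub_birkhoffAverage, smul_eq_mul]
  ring

end Ergodic

section LogMoments

theorem le_exp_logPos_sub_min_logNeg {y : ℝ≥0∞} (hy : logPos y ≠ ∞) (M : ℝ≥0∞) :
    y ≤ ENNReal.ofReal (Real.exp ((logPos y).toReal - (min (logNeg y) M).toReal)) := by
  rcases eq_or_ne y 0 with rfl | h0
  · exact zero_le
  rcases eq_or_ne y ∞ with rfl | htop
  · simp [logPos] at hy
  have hlog : ENNReal.log y = (Real.log y.toReal : EReal) := ENNReal.log_pos_real h0 htop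
  have hpos : (logPos y).toReal = max (Real.log y.toReal) 0 := by
    rw [logPos, hlog, EReal.real_coe_toENNReal, ENNReal.toReal_ofReal']
  have hneg : logNeg y = ENNReal.ofReal (-Real.log y.toReal) := by
    rw [logNeg, hlog, ← EReal.coe_neg, EReal.real_coe_toENNReal]
  have hmin : (min (logNeg y) M).toReal ≤ max (-Real.log y.toReal) 0 := by
    rw [← ENNReal.toReal_ofReal', ← hneg]
    exact ENNReal.toReal_mono (hneg ▸ ENNReal.ofReal_ne_top) (min_le_left _ _)
  rw [← ENNReal.ofReal_toReal htop]
  conv_lhs => rw [← Real.exp_log (ENNReal.toReal_pos h0 htop)]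
  rw [ENNReal.ofReal_toReal htop, hpos]
  gcongr
  rcases le_total (Real.log y.toReal) 0 with h | h
  · rw [max_eq_left (neg_nonneg.2 h)] at hmin
    linarith [le_max_right (Real.log y.toReal) 0]
  · rw [max_eq_right (neg_nonpos.2 h)] at hmin
    linarith [le_max_left (Real.log y.toReal) 0]

theorem measurable_logPos : Measurable logPos := ENNReal.measurable_log.ereal_toENNReal

theorem measurable_logNeg : Measurable logNeg := ENNReal.measurable_log.neg.ereal_toENNReal

variable {W W' : Type*} [MeasurableSpace W] [MeasurableSpace W'] {μ : Measure W} {ν : Measure W'}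
  {Y : W' → ℝ≥0∞}

theorem finiteLogPosMoment_comp_iff {f : W → W'} (hf : MeasurePreserving f μ ν)
    (hY : Measurable Y) : FiniteLogPosMoment μ (fun w => Y (f w)) ↔ FiniteLogPosMoment ν Y := by
  rw [FiniteLogPosMoment, FiniteLogPosMoment,
    hf.lintegral_comp (f := fun y => logPos (Y y)) (measurable_logPos.comp hY)]

theorem negativeLogMean_comp_iff {f : W → W'} (hf : MeasurePreserving f μ ν)
    (hY : Measurable Y) : NegativeLogMean μ (fun w => Y (f w)) ↔ NegativeLogMean ν Y := by
  rw [NegativeLogMean, NegativeLogMean,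
    hf.lintegral_comp (f := fun y => logPos (Y y)) (measurable_logPos.comp hY),
    hf.lintegral_comp (f := fun y => logNeg (Y y)) (measurable_logNeg.comp hY)]

theorem FiniteLogPosMoment.exists_le_exp (hY : Measurable Y) (h : FiniteLogPosMoment ν Y) :
    ∃ b : W' → ℝ, Measurable b ∧ Integrable b ν ∧ 0 ≤ b ∧
      ∀ᵐ w ∂ν, Y w ≤ ENNReal.ofReal (Real.exp (b w)) := by
  have hm : Measurable fun w => logPos (Y w) := measurable_logPos.comp hY
  refine ⟨fun w => (logPos (Y w)).toReal, hm.ennreal_toReal,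
    integrable_toReal_of_lintegral_ne_top hm.aemeasurable h.ne, fun w => ENNReal.toReal_nonneg, ?_⟩
  filter_upwards [ae_lt_top hm h.ne] with w hw
  simpa using le_exp_logPos_sub_min_logNeg hw.ne 0

theorem NegativeLogMean.exists_lintegral_lt_lintegral_min (hY : Measurable Y)
    (h : NegativeLogMean ν Y) :
    ∃ M : ℕ, ∫⁻ w, logPos (Y w) ∂ν < ∫⁻ w, min (logNeg (Y w)) M ∂ν := by
  have hn : Measurable fun w => logNeg (Y w) := measurable_logNeg.comp hY
  have hmono : Monotone fun (M : ℕ) w => min (logNeg (Y w)) M := fun M N hMN w => by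
    dsimp only
    gcongr
  have hsup : ∫⁻ w, logNeg (Y w) ∂ν = ⨆ M : ℕ, ∫⁻ w, min (logNeg (Y w)) M ∂ν := by
    rw [← lintegral_iSup (fun M => hn.min measurable_const) hmono]
    simp_rw [← inf_iSup_eq, ENNReal.iSup_natCast, inf_top_eq]
  rw [NegativeLogMean, hsup] at h
  exact lt_iSup_iff.1 h

theorem NegativeLogMean.exists_le_exp [IsFiniteMeasure ν] (hY : Measurable Y)
    (h : NegativeLogMean ν Y) :
    ∃ a : W' → ℝ, Measurable a ∧ Integrable a ν ∧ ∫ w, a w ∂ν < 0 ∧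
      ∀ᵐ w ∂ν, Y w ≤ ENNReal.ofReal (Real.exp (a w)) := by
  obtain ⟨M, hM⟩ := h.exists_lintegral_lt_lintegral_min hY
  have hp : Measurable fun w => logPos (Y w) := measurable_logPos.comp hY
  have hn : Measurable fun w => min (logNeg (Y w)) (M : ℝ≥0∞) :=
    (measurable_logNeg.comp hY).min measurable_const
  have hp_top : ∫⁻ w, logPos (Y w) ∂ν ≠ ∞ := hM.ne_top
  have hn_top : ∫⁻ w, min (logNeg (Y w)) M ∂ν ≠ ∞ :=
    ne_top_of_le_ne_top (by simp [ENNReal.mul_ne_top])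
      (lintegral_mono fun w => min_le_right _ (M : ℝ≥0∞))
  have hp_int := integrable_toReal_of_lintegral_ne_top hp.aemeasurable hp_top
  have hn_int := integrable_toReal_of_lintegral_ne_top hn.aemeasurable hn_top
  refine ⟨fun w => (logPos (Y w)).toReal - (min (logNeg (Y w)) M).toReal,
    hp.ennreal_toReal.sub hn.ennreal_toReal, hp_int.sub hn_int, ?_, ?_⟩
  · rw [integral_sub hp_int hn_int, integral_toReal hp.aemeasurable (ae_lt_top hp hp_top),
      integral_toReal hn.aemeasurable (ae_lt_top hn hn_top), sub_neg]
    exact (ENNReal.toReal_lt_toReal hp_top hn_top).2 hM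
  · filter_upwards [ae_lt_top hp hp_top] with w hw
    exact le_exp_logPos_sub_min_logNeg hw.ne _

theorem FiniteLogPosMoment.ae_eventually_iterate_le_pow [IsProbabilityMeasure ν] {T : W' → W'}
    (hT : Ergodic T ν) (hY : Measurable Y) (h : FiniteLogPosMoment ν Y) {γ : ℝ≥0} (hγ : 1 < γ) :
    ∀ᵐ w ∂ν, ∀ᶠ n : ℕ in atTop, Y (T^[n] w) ≤ (γ : ℝ≥0∞) ^ n := by
  obtain ⟨b, hb, hbi, -, hYb⟩ := h.exists_le_exp hY
  have hYb' : ∀ᵐ w ∂ν, ∀ n : ℕ, Y (T^[n] w) ≤ ENNReal.ofReal (Real.exp (b (T^[n] w))) :=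
    ae_all_iff.2 fun n => (hT.iterate n).quasiMeasurePreserving.ae hYb
  have hlog : 0 < Real.log γ := Real.log_pos (by exact_mod_cast hγ)
  filter_upwards [hYb', ae_tendsto_iterate_div_zero hT hb hbi] with w hw hlim
  filter_upwards [hlim.eventually_le_const hlog, eventually_gt_atTop 0] with n hn hn0
  calc Y (T^[n] w) ≤ ENNReal.ofReal (Real.exp (b (T^[n] w))) := hw n
    _ ≤ ENNReal.ofReal (Real.exp (n * Real.log γ)) := by
        gcongr
        rwa [div_le_iff₀' (by exact_mod_cast hn0)] at hn
    _ = (γ : ℝ≥0∞) ^ n := by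
        rw [Real.exp_nat_mul, Real.exp_log (by positivity), ENNReal.ofReal_pow (by positivity),
          ENNReal.ofReal_coe_nnreal]

end LogMoments

section Submultiplicative

/-- A submultiplicative cocycle `(L_n)` over the transformation `T`, with values in `[0, ∞]`. -/
structure IsSubmulCocycle {W : Type*} (T : W → W) (L : ℕ → W → ℝ≥0∞) : Prop where
  zero_le_one : ∀ w, L 0 w ≤ 1
  add_le : ∀ m n w, L (m + n) w ≤ L m w * L n (T^[m] w)

namespace IsSubmulCocycle

variable {W : Type*} {T : W → W} {L : ℕ → W → ℝ≥0∞}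

theorem le_prod (hL : IsSubmulCocycle T L) (n : ℕ) (w : W) :
    L n w ≤ ∏ j ∈ Finset.range n, L 1 (T^[j] w) := by
  induction n with
  | zero => simpa using hL.zero_le_one w
  | succ n ih =>
    rw [Finset.prod_range_succ]
    exact (hL.add_le n 1 w).trans (by gcongr)

/-- A common bound for all `L_l (T^i w)` with `i + l ≤ r`. -/
noncomputable def windowBound (T : W → W) (L : ℕ → W → ℝ≥0∞) (r : ℕ) (w : W) : ℝ≥0∞ :=
  ∏ j ∈ Finset.range r, max 1 (L 1 (T^[j] w))

theorem iterate_le_windowBound (hL : IsSubmulCocycle T L) {i l r : ℕ} (h : i + l ≤ r) (w : W) :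
    L l (T^[i] w) ≤ windowBound T L r w := by
  calc L l (T^[i] w) ≤ ∏ j ∈ Finset.range l, L 1 (T^[j] (T^[i] w)) := hL.le_prod l _
    _ ≤ ∏ j ∈ Finset.range l, max 1 (L 1 (T^[j + i] w)) := by
        simp_rw [Function.iterate_add_apply]
        gcongr
        exact le_max_right _ _
    _ = ∏ j ∈ Finset.Ico i (l + i), max 1 (L 1 (T^[j] w)) := by
        rw [Finset.prod_Ico_eq_prod_range, Nat.add_sub_cancel]
        simp_rw [add_comm i]
    _ ≤ windowBound T L r w := by
        refine Finset.prod_le_prod_of_subset_of_one_le'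
          (fun j hj => ?_) fun j _ _ => le_max_left _ _
        rw [Finset.mem_Ico] at hj
        exact Finset.mem_range.2 (by omega)

theorem prod_window_le (hL : IsSubmulCocycle T L) {r : ℕ} (hr : 1 ≤ r) (n : ℕ) (w : W) :
    ∏ i ∈ Finset.range r, L (n + i) w ≤
      (∏ i ∈ Finset.range r, L i w) * ∏ m ∈ Finset.range n, L r (T^[m] w) := by
  obtain ⟨r, rfl⟩ := Nat.exists_eq_add_of_le' hr
  induction n with
  | zero => simp
  | succ n ih =>
    calc ∏ i ∈ Finset.range (r + 1), L (n + 1 + i) w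
        = (∏ i ∈ Finset.range r, L (n + (i + 1)) w) * L (n + (r + 1)) w := by
          rw [Finset.prod_range_succ]
          simp_rw [add_assoc, add_comm 1]
      _ ≤ (∏ i ∈ Finset.range r, L (n + (i + 1)) w) * (L n w * L (r + 1) (T^[n] w)) := by
          gcongr
          exact hL.add_le _ _ _
      _ = (∏ i ∈ Finset.range (r + 1), L (n + i) w) * L (r + 1) (T^[n] w) := by
          rw [Finset.prod_range_succ', add_zero, mul_assoc]
      _ ≤ _ := by
          rw [Finset.prod_range_succ (fun m => L (r + 1) (T^[m] w)), ← mul_assoc]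
          gcongr

/-- The `r`-th power comes from averaging over the `r` ways of cutting `[0, n + r)` into blocks of
length `r`: only the powers of `T`, not `T^r`, need then be controlled. -/
theorem pow_le (hL : IsSubmulCocycle T L) {r : ℕ} (hr : 1 ≤ r) (n : ℕ) (w : W) :
    L (n + r) w ^ r ≤ windowBound T L r w ^ r * windowBound T L r (T^[n] w) ^ r *
      ∏ m ∈ Finset.range n, L r (T^[m] w) := by
  calc L (n + r) w ^ r = ∏ _i ∈ Finset.range r, L (n + r) w := by simp
    _ ≤ ∏ i ∈ Finset.range r, (L (n + i) w * windowBound T L r (T^[n] w)) := by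
        refine Finset.prod_le_prod' fun i hi => ?_
        have hir : i + (r - i) = r := Nat.add_sub_cancel' (Finset.mem_range.1 hi).le
        have hcut := hL.add_le (n + i) (r - i) w
        rw [add_assoc, hir, add_comm n i, Function.iterate_add_apply, add_comm i n] at hcut
        exact hcut.trans (by gcongr; exact hL.iterate_le_windowBound hir.le _)
    _ = (∏ i ∈ Finset.range r, L (n + i) w) * windowBound T L r (T^[n] w) ^ r := by
        simp [Finset.prod_mul_distrib]
    _ ≤ (∏ _i ∈ Finset.range r, windowBound T L r w) * (∏ m ∈ Finset.range n, L r (T^[m] w)) *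
          windowBound T L r (T^[n] w) ^ r := by
        gcongr
        refine (hL.prod_window_le hr n w).trans ?_
        gcongr with i hi
        exact hL.iterate_le_windowBound (i := 0) (by simpa using (Finset.mem_range.1 hi).le) w
    _ = _ := by
        rw [Finset.prod_const, Finset.card_range]
        ring

theorem prod_iterate_le_exp_birkhoffSum {Y : W → ℝ≥0∞} {a : W → ℝ} {w : W}
    (h : ∀ m : ℕ, Y (T^[m] w) ≤ ENNReal.ofReal (Real.exp (a (T^[m] w)))) (n : ℕ) :
    ∏ m ∈ Finset.range n, Y (T^[m] w) ≤ ENNReal.ofReal (Real.exp (birkhoffSum T a n w)) := by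
  rw [birkhoffSum, Real.exp_sum, ENNReal.ofReal_prod_of_nonneg fun _ _ => Real.exp_nonneg _]
  gcongr
  exact h _

theorem pow_le_exp (hL : IsSubmulCocycle T L) {r : ℕ} (hr : 1 ≤ r) {a b : W → ℝ} (hb0 : 0 ≤ b)
    {w : W} (hb : ∀ m : ℕ, L 1 (T^[m] w) ≤ ENNReal.ofReal (Real.exp (b (T^[m] w))))
    (ha : ∀ m : ℕ, L r (T^[m] w) ≤ ENNReal.ofReal (Real.exp (a (T^[m] w)))) (n : ℕ) :
    L (n + r) w ^ r ≤ ENNReal.ofReal (Real.exp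
      (r * birkhoffSum T b r w + r * birkhoffSum T b r (T^[n] w) + birkhoffSum T a n w)) := by
  have hwindow (k : ℕ) : windowBound T L r (T^[k] w) ≤
      ENNReal.ofReal (Real.exp (birkhoffSum T b r (T^[k] w))) := by
    refine prod_iterate_le_exp_birkhoffSum (Y := fun w => max 1 (L 1 w)) (fun m => max_le ?_ ?_) r
    · exact ENNReal.one_le_ofReal.2 (Real.one_le_exp (hb0 _))
    · rw [← Function.iterate_add_apply]
      exact hb _
  refine (hL.pow_le hr n w).trans ?_
  rw [Real.exp_add, Real.exp_add, Real.exp_nat_mul, Real.exp_nat_mul,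
    ENNReal.ofReal_mul (by positivity), ENNReal.ofReal_mul (by positivity),
    ENNReal.ofReal_pow (by positivity), ENNReal.ofReal_pow (by positivity)]
  gcongr
  · exact hwindow 0
  · exact hwindow n
  · exact prod_iterate_le_exp_birkhoffSum ha n

theorem eventually_le_pow (hL : IsSubmulCocycle T L) {r : ℕ} (hr : 1 ≤ r) {a b : W → ℝ}
    (hb0 : 0 ≤ b) {w : W}
    (hb : ∀ m : ℕ, L 1 (T^[m] w) ≤ ENNReal.ofReal (Real.exp (b (T^[m] w))))
    (ha : ∀ m : ℕ, L r (T^[m] w) ≤ ENNReal.ofReal (Real.exp (a (T^[m] w)))) {α β : ℝ}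
    (hα : Tendsto (fun n => birkhoffAverage ℝ T a n w) atTop (𝓝 α)) (hαβ : α < β)
    (hbT : Tendsto (fun n : ℕ => birkhoffSum T b r (T^[n] w) / n) atTop (𝓝 0)) :
    ∀ᶠ n in atTop, L n w ≤ ((Real.exp (β / r)).toNNReal : ℝ≥0∞) ^ n := by
  have hlim : Tendsto (fun n : ℕ => (r * birkhoffSum T b r w - β * r) / n +
      r * (birkhoffSum T b r (T^[n] w) / n) + birkhoffAverage ℝ T a n w) atTop (𝓝 α) := by
    simpa using ((tendsto_const_div_atTop_nhds_zero_nat _).add (hbT.const_mul (r : ℝ))).add hα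
  rw [← map_add_atTop_eq_nat r, eventually_map]
  filter_upwards [hlim.eventually_le_const hαβ, eventually_gt_atTop 0] with n hn hn0
  have hexponent : r * birkhoffSum T b r w + r * birkhoffSum T b r (T^[n] w) +
      birkhoffSum T a n w ≤ r * ((n + r : ℕ) * (β / r)) := by
    have hn' : (0 : ℝ) < n := by exact_mod_cast hn0
    have hr' : (r : ℝ) ≠ 0 := by positivity
    rw [birkhoffAverage, smul_eq_mul] at hn
    field_simp at hn ⊢
    push_cast
    linarith
  refine (ENNReal.pow_le_pow_left_iff (n := r) (by omega)).1 ?_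
  calc L (n + r) w ^ r
      ≤ ENNReal.ofReal (Real.exp (r * ((n + r : ℕ) * (β / r)))) :=
        (hL.pow_le_exp hr hb0 hb ha n).trans (by gcongr)
    _ = (((Real.exp (β / r)).toNNReal : ℝ≥0∞) ^ (n + r)) ^ r := by
        rw [Real.exp_nat_mul, Real.exp_nat_mul, ENNReal.ofReal_pow (by positivity),
          ENNReal.ofReal_pow (by positivity)]
        rfl

theorem exists_ae_eventually_le_pow [MeasurableSpace W] {μ : Measure W} [IsProbabilityMeasure μ]
    (hL : IsSubmulCocycle T L) (hT : Ergodic T μ) (hL1 : Measurable (L 1))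
    (hpos : FiniteLogPosMoment μ (L 1)) {r : ℕ} (hr : 1 ≤ r) (hLr : Measurable (L r))
    (hneg : NegativeLogMean μ (L r)) :
    ∃ ρ : ℝ≥0, ρ < 1 ∧ ∀ᵐ w ∂μ, ∀ᶠ n : ℕ in atTop, L n w ≤ (ρ : ℝ≥0∞) ^ n := by
  obtain ⟨b, hbm, hbi, hb0, hb⟩ := hpos.exists_le_exp hL1
  obtain ⟨a, ham, hai, ha0, ha⟩ := hneg.exists_le_exp hLr
  have hiter {p : W → Prop} (hp : ∀ᵐ w ∂μ, p w) : ∀ᵐ w ∂μ, ∀ m : ℕ, p (T^[m] w) :=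
    ae_all_iff.2 fun m => (hT.iterate m).quasiMeasurePreserving.ae hp
  have hSm : Measurable (birkhoffSum T b r) :=
    Finset.measurable_fun_sum _ fun m _ => hbm.comp (hT.measurable.iterate m)
  have hSi : Integrable (birkhoffSum T b r) μ :=
    integrable_finsetSum _ fun m _ => (hT.iterate m).integrable_comp_of_integrable hbi
  obtain ⟨β, haβ, hβ⟩ := exists_between ha0
  have hr' : (0 : ℝ) < r := by exact_mod_cast hr
  refine ⟨(Real.exp (β / r)).toNNReal, ?_, ?_⟩
  · rw [Real.toNNReal_lt_one, Real.exp_lt_one_iff]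
    exact div_neg_of_neg_of_pos hβ hr'
  · filter_upwards [hiter ha, hiter hb, ae_tendsto_birkhoffAverage hT ham hai,
      ae_tendsto_iterate_div_zero hT hSm hSi] with w haw hbw havg hSw
    exact hL.eventually_le_pow hr hb0 hbw haw havg haβ hSw

end IsSubmulCocycle

end Submultiplicative

section Lipschitz

variable {E : Type*} [MetricSpace E]

theorem edist_le_lipCoeff_mul (φ : E → E) (x y : E) :
    edist (φ x) (φ y) ≤ lipCoeff φ * edist x y := by
  rcases eq_or_ne x y with rfl | h
  · simp
  · rw [← ENNReal.div_le_iff (edist_pos.2 h).ne' (edist_ne_top x y)]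
    exact le_iSup_of_le x (le_iSup_of_le y (le_iSup_of_le h le_rfl))

theorem lipCoeff_le_iff {φ : E → E} {C : ℝ≥0∞} :
    lipCoeff φ ≤ C ↔ ∀ x y, edist (φ x) (φ y) ≤ C * edist x y :=
  ⟨fun h x y => (edist_le_lipCoeff_mul φ x y).trans (by gcongr),
    fun h => iSup_le fun x => iSup_le fun y => iSup_le fun hxy =>
      (ENNReal.div_le_iff (edist_pos.2 hxy).ne' (edist_ne_top x y)).2 (h x y)⟩

theorem lipCoeff_le_coe_iff {φ : E → E} {C : ℝ≥0} : lipCoeff φ ≤ C ↔ LipschitzWith C φ :=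
  lipCoeff_le_iff

theorem lipCoeff_id_le : lipCoeff (id : E → E) ≤ 1 :=
  lipCoeff_le_iff.2 fun x y => by simp

theorem lipCoeff_comp_le (φ ψ : E → E) : lipCoeff (φ ∘ ψ) ≤ lipCoeff φ * lipCoeff ψ :=
  lipCoeff_le_iff.2 fun x y => (edist_le_lipCoeff_mul φ _ _).trans <| by
    rw [mul_assoc]
    gcongr
    exact edist_le_lipCoeff_mul ψ x y

theorem lipCoeff_eq_iSup_dense {φ : E → E} (hφ : Continuous φ) {S : Set E} (hS : Dense S) :
    lipCoeff φ = ⨆ (x : S) (y : S), edist (φ x) (φ y) / edist (x : E) y := by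
  apply le_antisymm
  · set C := ⨆ (x : S) (y : S), edist (φ x) (φ y) / edist (x : E) y
    rcases eq_or_ne C ∞ with h | h
    · exact h ▸ le_top
    refine lipCoeff_le_iff.2 fun x y => ?_
    refine isClosed_property2 (p := fun x y => edist (φ x) (φ y) ≤ C * edist x y)
      hS.denseRange_val ?_ ?_ x y
    · exact isClosed_le (by fun_prop) ((ENNReal.continuous_const_mul h).comp (by fun_prop))
    · rintro ⟨x, hx⟩ ⟨y, hy⟩
      rcases eq_or_ne x y with rfl | hxy
      · simp
      · rw [← ENNReal.div_le_iff (edist_pos.2 hxy).ne' (edist_ne_top x y)]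
        exact le_iSup_of_le (⟨x, hx⟩ : S) (le_iSup_of_le (⟨y, hy⟩ : S) le_rfl)
  · refine iSup_le fun x => iSup_le fun y => ?_
    rcases eq_or_ne (x : E) y with h | h
    · simp [h]
    · exact le_iSup_of_le (x : E) (le_iSup_of_le (y : E) (le_iSup_of_le h le_rfl))

theorem measurable_lipCoeff [SecondCountableTopology E] [MeasurableSpace E] [BorelSpace E]
    {W : Type*} [MeasurableSpace W] {φ : W → E → E} (hφ : ∀ w, Continuous (φ w))
    (hm : ∀ s, Measurable fun w => φ w s) : Measurable fun w => lipCoeff (φ w) := by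
  obtain ⟨S, hSc, hS⟩ := exists_countable_dense E
  have := hSc.to_subtype
  simp_rw [lipCoeff_eq_iSup_dense (hφ _) hS]
  exact .iSup fun x => .iSup fun y => ((hm x).edist (hm y)).div_const _

end Lipschitz

section PastIterate

variable {E : Type*}

theorem pastIterate_add (φ : ℤ → E → E) (t : ℤ) (m n : ℕ) :
    pastIterate φ t (m + n) = pastIterate φ t m ∘ pastIterate φ (t - m) n := by
  induction n with
  | zero => rfl
  | succ n ih =>
    rw [← add_assoc, pastIterate, ih, pastIterate, Function.comp_assoc, Nat.cast_add, sub_sub]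

theorem pastIterate_succ_apply (φ : ℤ → E → E) (t : ℤ) (n : ℕ) (x : E) :
    pastIterate φ t (n + 1) x = φ t (pastIterate φ (t - 1) n x) := by
  rw [add_comm n 1, pastIterate_add]
  simp [pastIterate]

theorem pastIterate_comp_add (φ : ℤ → E → E) (s t : ℤ) (n : ℕ) :
    pastIterate (fun k => φ (k + s)) t n = pastIterate φ (t + s) n := by
  induction n with
  | zero => rfl
  | succ n ih => rw [pastIterate, pastIterate, ih, sub_add_eq_add_sub]

theorem semiconj_pastIterate {E' : Type*} {e : E → E'} {φ : ℤ → E → E} {φ' : ℤ → E' → E'}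
    (h : ∀ t, Function.Semiconj e (φ t) (φ' t)) (t : ℤ) (n : ℕ) :
    Function.Semiconj e (pastIterate φ t n) (pastIterate φ' t n) := by
  induction n with
  | zero => exact .id_right
  | succ n ih => exact ih.comp_right (h _)

theorem eq_pastIterate {φ : ℤ → E → E} {s : ℤ → E} (h : ∀ t, s (t + 1) = φ t (s t)) (t : ℤ)
    (n : ℕ) : s t = pastIterate φ (t - 1) n (s (t - n)) := by
  induction n with
  | zero => simp [pastIterate]
  | succ n ih =>
    have hn : s (t - n) = φ (t - 1 - n) (s (t - (n + 1 : ℕ))) := by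
      convert h (t - 1 - n) using 2 <;> [ring; (congr 1; push_cast; ring)]
    rw [ih, pastIterate, Function.comp_apply, hn]

theorem continuous_pastIterate [TopologicalSpace E] {φ : ℤ → E → E} (h : ∀ t, Continuous (φ t))
    (t : ℤ) (n : ℕ) : Continuous (pastIterate φ t n) := by
  induction n with
  | zero => exact continuous_id
  | succ n ih => exact ih.comp (h _)

theorem measurable_pastIterate [MetricSpace E] [SecondCountableTopology E] [MeasurableSpace E]
    [BorelSpace E] {W : Type*} {m : MeasurableSpace W} {φ : ℤ → W → E → E}
    (hφ : ∀ t w, Continuous (φ t w)) {t : ℤ} (hm : ∀ k ≤ t, ∀ s, Measurable fun w => φ k w s)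
    (n : ℕ) {u : W → E} (hu : Measurable u) :
    Measurable fun w => pastIterate (fun k => φ k w) t n (u w) := by
  induction n generalizing u with
  | zero => exact hu
  | succ n ih =>
    have hφm : Measurable (Function.uncurry fun s w => φ (t - n) w s) :=
      measurable_uncurry_of_continuous_of_measurable (hφ (t - n)) (hm _ (by omega))
    exact ih (hφm.comp (hu.prodMk measurable_id))

end PastIterate

section Shift

variable {F : Type*}

/-- The shift by `t ∈ ℤ` on the path space; `shiftBy 1` is `shift`. -/
def shiftBy (t : ℤ) (w : ℤ → F) : ℤ → F := fun k => w (k + t)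

theorem shiftBy_shiftBy (s t : ℤ) (w : ℤ → F) : shiftBy s (shiftBy t w) = shiftBy (s + t) w := by
  ext k
  simp [shiftBy, add_assoc]

theorem shiftBy_zero (w : ℤ → F) : shiftBy 0 w = w := by
  ext k
  simp [shiftBy]

theorem shiftBy_iterate (t : ℤ) (n : ℕ) (w : ℤ → F) :
    (shiftBy t)^[n] w = shiftBy (n * t) w := by
  induction n with
  | zero => simpa using (shiftBy_zero w).symm
  | succ n ih => rw [Function.iterate_succ_apply', ih, shiftBy_shiftBy, Nat.cast_succ, add_one_mul,
      add_comm]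

variable [MeasurableSpace F]

theorem measurable_shiftBy (t : ℤ) : Measurable (shiftBy (F := F) t) :=
  measurable_pi_lambda _ fun _ => measurable_pi_apply _

variable (F) in
/-- The time shift as an automorphism of the path space. -/
def shiftEquiv : (ℤ → F) ≃ᵐ (ℤ → F) where
  toFun := shift
  invFun := shiftBy (-1)
  left_inv w := (shiftBy_shiftBy (-1) 1 w).trans (shiftBy_zero w)
  right_inv w := (shiftBy_shiftBy 1 (-1) w).trans (shiftBy_zero w)
  measurable_toFun := measurable_shiftBy 1
  measurable_invFun := measurable_shiftBy (-1)

variable {μ : Measure (ℤ → F)}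

theorem ergodic_shiftBy_neg_one (h : Ergodic shift μ) : Ergodic (shiftBy (-1)) μ :=
  Ergodic.symm (e := shiftEquiv F) h

theorem measurePreserving_shiftBy (h : MeasurePreserving shift μ μ) (t : ℤ) :
    MeasurePreserving (shiftBy t) μ μ := by
  have hfwd : MeasurePreserving (shiftBy 1) μ μ := h
  have hinv : MeasurePreserving (shiftBy (-1)) μ μ := MeasurePreserving.symm (shiftEquiv F) h
  obtain ⟨n, rfl | rfl⟩ := t.eq_nat_or_neg
  · convert! hfwd.iterate n using 1
    exact funext fun w => by simpa using (shiftBy_iterate 1 n w).symm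
  · convert! hinv.iterate n using 1
    exact funext fun w => by simpa using (shiftBy_iterate (-1) n w).symm

end Shift

section Stationary

variable {Ω F E : Type*} [MeasurableSpace Ω] [MeasurableSpace F] [MeasurableSpace E]
  {P : Measure Ω}

theorem IsStationaryErgodic.isStationary {v : ℤ → Ω → E} (h : IsStationaryErgodic P v) :
    IsStationary P v :=
  ⟨h.1, h.2.toMeasurePreserving⟩

theorem IsStationary.measurePreserving_path {v : ℤ → Ω → E} (h : IsStationary P v) (t : ℤ) :
    MeasurePreserving (fun ω k => v (k + t) ω) P (P.map fun ω k => v k ω) :=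
  (measurePreserving_shiftBy h.2 t).comp ((measurable_pi_lambda _ h.1).measurePreserving P)

theorem IsStationary.ae_forall_shift {v : ℤ → Ω → E} (h : IsStationary P v) {p : (ℤ → E) → Prop}
    (hp : ∀ᵐ w ∂P.map fun ω k => v k ω, p w) : ∀ᵐ ω ∂P, ∀ t, p fun k => v (k + t) ω :=
  ae_all_iff.2 fun t => (h.measurePreserving_path t).quasiMeasurePreserving.ae hp

theorem IsStationary.identDistrib {v : ℤ → Ω → E} (h : IsStationary P v) (t : ℤ) :
    IdentDistrib (v t) (v 0) P P := by
  have hpath : ∀ s, Measurable fun ω k => v (k + s) ω := fun s =>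
    (h.measurePreserving_path s).measurable
  have hid : IdentDistrib (fun ω k => v (k + t) ω) (fun ω k => v (k + 0) ω) P P :=
    ⟨(hpath t).aemeasurable, (hpath 0).aemeasurable,
      (h.measurePreserving_path t).map_eq.trans (h.measurePreserving_path 0).map_eq.symm⟩
  simpa [Function.comp_def] using hid.comp (measurable_pi_apply 0)

theorem IsStationaryErgodic.factor {v : ℤ → Ω → F} (h : IsStationaryErgodic P v)
    {G : (ℤ → F) → ℤ → E} (hG : Measurable G) (hcomm : ∀ w, G (shift w) = shift (G w)) :
    IsStationaryErgodic P fun t ω => G (fun k => v k ω) t := by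
  have hv : Measurable fun ω t => v t ω := measurable_pi_lambda _ h.1
  refine ⟨fun t => (measurable_pi_apply t).comp (hG.comp hv), ?_⟩
  have hmap : P.map (fun ω t => G (fun k => v k ω) t) = (P.map fun ω t => v t ω).map G :=
    (Measure.map_map hG hv).symm
  rw [hmap]
  exact (hG.measurePreserving _).ergodic_of_ergodic_semiconj h.2 (measurable_shiftBy 1) hcomm

theorem IsStationaryErgodic.comp {v : ℤ → Ω → F} (h : IsStationaryErgodic P v) {f : F → E}
    (hf : Measurable f) :
    IsStationaryErgodic P fun t ω => f (v t ω) :=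
  h.factor (G := fun w t => f (w t))
    (measurable_pi_lambda _ fun t => hf.comp (measurable_pi_apply t)) fun _ => rfl

theorem IsStationaryErgodic.congr_ae {v v' : ℤ → Ω → E} (h : IsStationaryErgodic P v)
    (hv' : ∀ t, Measurable (v' t)) (hae : ∀ᵐ ω ∂P, ∀ t, v' t ω = v t ω) :
    IsStationaryErgodic P v' := by
  refine ⟨hv', ?_⟩
  have hpath : (fun ω t => v' t ω) =ᵐ[P] fun ω t => v t ω := hae.mono fun ω hω => funext hω
  rw [Measure.map_congr hpath]
  exact h.2

end Stationary

section Cocycle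

variable {F E : Type*} [MetricSpace E]

theorem isSubmulCocycle_forward (ψ : F → E → E) :
    IsSubmulCocycle (shiftBy 1)
      fun n w => lipCoeff (pastIterate (fun k => ψ (w k)) ((n : ℤ) - 1) n) where
  zero_le_one _ := lipCoeff_id_le
  add_le m n w := by
    simp only [shiftBy_iterate, shiftBy, mul_one]
    rw [pastIterate_comp_add (fun k => ψ (w k)), add_comm m n, pastIterate_add, mul_comm,
      show ((n + m : ℕ) : ℤ) - 1 - n = m - 1 by push_cast; ring,
      show ((n + m : ℕ) : ℤ) - 1 = n - 1 + m by push_cast; ring]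
    exact lipCoeff_comp_le _ _

theorem isSubmulCocycle_backward (ψ : F → E → E) :
    IsSubmulCocycle (shiftBy (-1)) fun n w => lipCoeff (pastIterate (fun k => ψ (w k)) 0 n) where
  zero_le_one _ := lipCoeff_id_le
  add_le m n w := by
    simp only [shiftBy_iterate, shiftBy, mul_neg, mul_one]
    rw [pastIterate_comp_add (fun k => ψ (w k)), pastIterate_add, zero_sub, zero_add]
    exact lipCoeff_comp_le _ _

end Cocycle

section Limit

variable {E : Type*} [MetricSpace E]

theorem exists_one_lt_mul_lt_one {ρ : ℝ≥0} (hρ : ρ < 1) : ∃ γ : ℝ≥0, 1 < γ ∧ ρ * γ < 1 := by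
  refine ⟨2 / (1 + ρ), ?_, ?_⟩
  · rw [one_lt_div (by positivity), ← one_add_one_eq_two]
    gcongr
  · rw [← mul_div_assoc, div_lt_one (by positivity), mul_two]
    gcongr

theorem cauchySeq_pastIterate {φ : ℤ → E → E} {t : ℤ} {x₀ x₁ : E} {ρ γ : ℝ≥0} (hρ : ρ < 1)
    (hργ : ρ * γ < 1) (hφ : ∀ᶠ n in atTop, LipschitzWith (ρ ^ n) (pastIterate φ t n))
    (hx : ∀ᶠ n : ℕ in atTop, edist (φ (t - n) x₀) x₁ ≤ (γ : ℝ≥0∞) ^ n) :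
    CauchySeq fun n => pastIterate φ t n x₀ := by
  have hsum : Summable fun n : ℕ => ((ρ * γ) ^ n + ρ ^ n * nndist x₁ x₀ : ℝ≥0) :=
    (NNReal.summable_geometric hργ).add ((NNReal.summable_geometric hρ).mul_right _)
  refine cauchySeq_of_summable_dist
    (.of_norm_bounded_eventually_nat (NNReal.summable_coe.2 hsum) ?_)
  filter_upwards [hφ, hx] with n hφn hxn
  have hxn' : nndist (φ (t - n) x₀) x₁ ≤ γ ^ n := by
    rwa [edist_nndist, ← ENNReal.coe_pow, ENNReal.coe_le_coe] at hxn
  rw [Real.norm_of_nonneg dist_nonneg, dist_comm, ← coe_nndist, NNReal.coe_le_coe]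
  calc nndist (pastIterate φ t n (φ (t - n) x₀)) (pastIterate φ t n x₀)
      ≤ ρ ^ n * nndist (φ (t - n) x₀) x₀ := hφn.nndist_le _ _
    _ ≤ ρ ^ n * (γ ^ n + nndist x₁ x₀) := by
      gcongr
      exact (nndist_triangle _ x₁ _).trans (by gcongr)
    _ = (ρ * γ) ^ n + ρ ^ n * nndist x₁ x₀ := by ring

/-- The limit of the backward iterates `φ_{t-1} ∘ ⋯ ∘ φ_{t-n}(x₀)`, a junk value when they
diverge. -/
noncomputable def backwardLimit (φ : ℤ → E → E) (x₀ : E) (t : ℤ) : E :=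
  haveI : Nonempty E := ⟨x₀⟩
  limUnder atTop fun n => pastIterate φ (t - 1) n x₀

theorem tendsto_backwardLimit [CompleteSpace E] {φ : ℤ → E → E} {x₀ : E} {t : ℤ}
    (h : CauchySeq fun n => pastIterate φ (t - 1) n x₀) :
    Tendsto (fun n => pastIterate φ (t - 1) n x₀) atTop (𝓝 (backwardLimit φ x₀ t)) :=
  h.tendsto_limUnder

theorem backwardLimit_comp_add (φ : ℤ → E → E) (x₀ : E) (s t : ℤ) :
    backwardLimit (fun k => φ (k + s)) x₀ t = backwardLimit φ x₀ (t + s) := by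
  simp only [backwardLimit, pastIterate_comp_add, sub_add_eq_add_sub]

theorem backwardLimit_add_one [CompleteSpace E] {φ : ℤ → E → E} {x₀ : E} {t : ℤ}
    (hφ : Continuous (φ t)) (h : ∀ t, CauchySeq fun n => pastIterate φ (t - 1) n x₀) :
    backwardLimit φ x₀ (t + 1) = φ t (backwardLimit φ x₀ t) := by
  have hsucc := (tendsto_backwardLimit (h (t + 1))).comp (tendsto_add_atTop_nat 1)
  have himage := (hφ.tendsto _).comp (tendsto_backwardLimit (h t))
  refine tendsto_nhds_unique hsucc (himage.congr fun n => ?_)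
  simp only [Function.comp_apply, pastIterate_succ_apply, add_sub_cancel_right]

theorem measurable_backwardLimit [CompleteSpace E] [SecondCountableTopology E] [MeasurableSpace E]
    [BorelSpace E] {W : Type*} {_ : MeasurableSpace W} {φ : ℤ → W → E → E}
    (hφ : ∀ t w, Continuous (φ t w)) (x₀ : E) {t : ℤ}
    (hm : ∀ k ≤ t - 1, ∀ s, Measurable fun w => φ k w s) :
    Measurable fun w => backwardLimit (fun k => φ k w) x₀ t :=
  haveI : Nonempty E := ⟨x₀⟩
  (StronglyMeasurable.limUnder fun n =>
    (measurable_pastIterate hφ hm n measurable_const).stronglyMeasurable).measurable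

theorem tendsto_pow_mul_dist_pastIterate {φ : ℤ → E → E} {s : ℤ → E} {x₀ : E} {ρ γ : ℝ≥0}
    (hργ : ρ * γ < 1) (hs : ∀ t, s (t + 1) = φ t (s t))
    (hφ : ∀ᶠ n : ℕ in atTop, LipschitzWith (ρ ^ n) (pastIterate φ (n - 1) n)) :
    Tendsto (fun n : ℕ => (γ : ℝ) ^ n * dist (pastIterate φ (n - 1) n x₀) (s n)) atTop (𝓝 0) := by
  have hlim : Tendsto (fun n : ℕ => (ρ * γ : ℝ) ^ n * dist x₀ (s 0)) atTop (𝓝 0) := by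
    simpa using (tendsto_pow_atTop_nhds_zero_of_lt_one (by positivity)
      (by exact_mod_cast hργ : (ρ * γ : ℝ) < 1)).mul_const (dist x₀ (s 0))
  refine squeeze_zero' (.of_forall fun n => by positivity) ?_ hlim
  filter_upwards [hφ] with n hn
  have hsn : s n = pastIterate φ (n - 1) n (s 0) := by simpa using eq_pastIterate hs n n
  calc γ ^ n * dist (pastIterate φ (n - 1) n x₀) (s n)
      ≤ γ ^ n * (ρ ^ n * dist x₀ (s 0)) := by
        rw [hsn]
        gcongr
        exact_mod_cast hn.dist_le_mul x₀ (s 0)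
    _ = (ρ * γ : ℝ) ^ n * dist x₀ (s 0) := by ring

end Limit

section Uniqueness

variable {Ω : Type*} [MeasurableSpace Ω] {P : Measure Ω}

theorem tendstoInMeasure_mul_of_identDistrib [IsFiniteMeasure P] {c : ℕ → ℝ} {A : ℤ → Ω → ℝ}
    (hc : Tendsto c atTop (𝓝 0)) (hA : ∀ t, IdentDistrib (A t) (A 0) P P) (t : ℕ → ℤ) :
    TendstoInMeasure P (fun n ω => c n * A (t n) ω) atTop fun _ => 0 := by
  have h0 : TendstoInMeasure P (fun n ω => c n * A 0 ω) atTop fun _ => 0 :=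
    tendstoInMeasure_of_tendsto_ae
      (fun n => ((hA 0).aemeasurable_fst.const_mul (c n)).aestronglyMeasurable)
      (.of_forall fun ω => by simpa using hc.mul_const (A 0 ω))
  refine fun ε hε => (h0 ε hε).congr fun n => ?_
  exact ((hA (t n)).measure_mem_eq
    (s := {a | ε ≤ edist (c n * a) 0}) (measurableSet_le measurable_const (by fun_prop))).symm

theorem ae_exists_subseq_mul_tendsto_zero [IsFiniteMeasure P] {c : ℕ → ℝ} {A B : ℤ → Ω → ℝ}
    (hc : Tendsto c atTop (𝓝 0)) (hA : ∀ t, IdentDistrib (A t) (A 0) P P)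
    (hB : ∀ t, IdentDistrib (B t) (B 0) P P) (t : ℕ → ℤ) :
    ∃ ns : ℕ → ℕ, Tendsto ns atTop atTop ∧ ∀ᵐ ω ∂P,
      Tendsto (fun i => c (ns i) * (A (t (ns i)) ω + B (t (ns i)) ω)) atTop (𝓝 0) := by
  obtain ⟨ns, hns, hAns⟩ :=
    (tendstoInMeasure_mul_of_identDistrib hc hA t).exists_seq_tendsto_ae
  obtain ⟨ms, hms, hBms⟩ := (tendstoInMeasure_mul_of_identDistrib
    (hc.comp hns.tendsto_atTop) hB (t ∘ ns)).exists_seq_tendsto_ae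
  refine ⟨ns ∘ ms, hns.tendsto_atTop.comp hms.tendsto_atTop, ?_⟩
  filter_upwards [hAns, hBms] with ω hAω hBω
  simpa [mul_add, Function.comp_def] using (hAω.comp hms.tendsto_atTop).add hBω

theorem IsSRESolution.congr_ae {E : Type*} {Φ : ℤ → Ω → E → E} {u v : ℤ → Ω → E}
    (hv : IsSRESolution P Φ v) (huv : ∀ᵐ ω ∂P, ∀ t, u t ω = v t ω) : IsSRESolution P Φ u := by
  intro t
  filter_upwards [hv t, huv] with ω hω huvω
  rw [huvω, huvω, hω]

theorem IsSRESolution.ae_eq_of_identDistrib [IsProbabilityMeasure P] {E : Type*} [MetricSpace E]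
    [MeasurableSpace E] [OpensMeasurableSpace E] {Φ : ℤ → Ω → E → E} {u v : ℤ → Ω → E}
    {C : ℕ → ℝ≥0} (hu : IsSRESolution P Φ u) (hv : IsSRESolution P Φ v)
    (hui : ∀ t, IdentDistrib (u t) (u 0) P P) (hvi : ∀ t, IdentDistrib (v t) (v 0) P P)
    (hC : Tendsto C atTop (𝓝 0)) (hΦ : ∀ᵐ ω ∂P, ∀ t, ∀ᶠ n in atTop,
      LipschitzWith (C n) (pastIterate (fun k => Φ k ω) t n)) (t : ℤ) :
    ∀ᵐ ω ∂P, u t ω = v t ω := by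
  obtain ⟨ω₀⟩ : Nonempty Ω := P.nonempty_of_neZero
  let x₀ := u 0 ω₀
  have hdist : Measurable fun x => dist x x₀ := by fun_prop
  obtain ⟨ns, hns, hlim⟩ := ae_exists_subseq_mul_tendsto_zero (NNReal.tendsto_coe.2 hC)
    (fun s => (hui s).comp hdist) (fun s => (hvi s).comp hdist) (fun n => t - n)
  filter_upwards [ae_all_iff.2 hu, ae_all_iff.2 hv, hΦ, hlim] with ω huω hvω hΦω hlimω
  refine dist_le_zero.1 (ge_of_tendsto hlimω ?_)
  filter_upwards [hns.eventually (hΦω (t - 1))] with i hi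
  have hun : u t ω = _ := eq_pastIterate (s := fun k => u k ω) huω t (ns i)
  have hvn : v t ω = _ := eq_pastIterate (s := fun k => v k ω) hvω t (ns i)
  rw [hun, hvn]
  refine (hi.dist_le_mul _ _).trans ?_
  gcongr
  exact dist_triangle_right _ _ _

end Uniqueness

section Contractive

variable {Ω F E : Type*} [MeasurableSpace Ω] [MeasurableSpace F] [MetricSpace E]
  [MeasurableSpace E] {P : Measure Ω} {ψ : F → E → E} {ξ : ℤ → Ω → F}

/-- Bougerol's contraction conditions for the recurrence equation `s_{t+1} = ψ(ξ_t)(s_t)` driven by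
a stationary ergodic sequence `(ξ_t)`. -/
structure IsContractiveSRE (P : Measure Ω) (ψ : F → E → E) (ξ : ℤ → Ω → F) : Prop where
  stationary_ergodic : IsStationaryErgodic P ξ
  continuous : ∀ x, Continuous (ψ x)
  measurable : ∀ s, Measurable fun x => ψ x s
  logPos_lipCoeff : FiniteLogPosMoment P fun ω => lipCoeff (ψ (ξ 0 ω))
  exists_negativeLogMean : ∃ r : ℕ, 1 ≤ r ∧
    NegativeLogMean P fun ω => lipCoeff (pastIterate (fun t => ψ (ξ t ω)) 0 r)

namespace IsContractiveSRE

theorem measurePreserving_path (h : IsContractiveSRE P ψ ξ) :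
    MeasurePreserving (fun ω k => ξ k ω) P (P.map fun ω k => ξ k ω) :=
  (measurable_pi_lambda _ h.stationary_ergodic.1).measurePreserving P

theorem measurable_lipCoeff_pastIterate [SecondCountableTopology E] [BorelSpace E]
    (h : IsContractiveSRE P ψ ξ) (t : ℤ) (n : ℕ) :
    Measurable fun w : ℤ → F => lipCoeff (pastIterate (fun k => ψ (w k)) t n) :=
  measurable_lipCoeff (fun w => continuous_pastIterate (fun k => h.continuous (w k)) t n)
    fun _ => measurable_pastIterate (φ := fun k (w : ℤ → F) => ψ (w k))
      (fun k w => h.continuous (w k))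
      (fun k _ s => (h.measurable s).comp (measurable_pi_apply k)) n measurable_const

theorem isStationaryErgodic_backwardLimit [CompleteSpace E] [SecondCountableTopology E]
    [BorelSpace E] (h : IsContractiveSRE P ψ ξ) (x₀ : E) :
    IsStationaryErgodic P fun t ω => backwardLimit (fun k => ψ (ξ k ω)) x₀ t := by
  have hm : Measurable fun (w : ℤ → F) t => backwardLimit (fun k => ψ (w k)) x₀ t :=
    measurable_pi_lambda _ fun t => measurable_backwardLimit (φ := fun k (w : ℤ → F) => ψ (w k))
      (fun k w => h.continuous (w k)) x₀
      fun k _ s => (h.measurable s).comp (measurable_pi_apply k)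
  exact h.stationary_ergodic.factor hm fun w =>
    funext fun t => backwardLimit_comp_add (fun k => ψ (w k)) x₀ 1 t

variable [IsProbabilityMeasure P]

theorem exists_ae_lipschitzWith_backward [SecondCountableTopology E] [BorelSpace E]
    (h : IsContractiveSRE P ψ ξ) :
    ∃ ρ : ℝ≥0, ρ < 1 ∧ ∀ᵐ ω ∂P, ∀ t : ℤ, ∀ᶠ n in atTop,
      LipschitzWith (ρ ^ n) (pastIterate (fun k => ψ (ξ k ω)) t n) := by
  obtain ⟨r, hr, hneg⟩ := h.exists_negativeLogMean
  have := Measure.isProbabilityMeasure_map (μ := P) h.measurePreserving_path.aemeasurable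
  have hL := h.measurable_lipCoeff_pastIterate 0
  obtain ⟨ρ, hρ, hev⟩ := (isSubmulCocycle_backward ψ).exists_ae_eventually_le_pow
    (ergodic_shiftBy_neg_one h.stationary_ergodic.2) (hL 1)
    ((finiteLogPosMoment_comp_iff h.measurePreserving_path (hL 1)).1 h.logPos_lipCoeff) hr (hL r)
    ((negativeLogMean_comp_iff h.measurePreserving_path (hL r)).1 hneg)
  refine ⟨ρ, hρ, ?_⟩
  filter_upwards [h.stationary_ergodic.isStationary.ae_forall_shift hev] with ω hω t
  filter_upwards [hω t] with n hn
  rwa [pastIterate_comp_add (fun k => ψ (ξ k ω)), zero_add, ← ENNReal.coe_pow,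
    lipCoeff_le_coe_iff] at hn

theorem exists_ae_lipschitzWith_forward [SecondCountableTopology E] [BorelSpace E]
    (h : IsContractiveSRE P ψ ξ) :
    ∃ ρ : ℝ≥0, ρ < 1 ∧ ∀ᵐ ω ∂P, ∀ᶠ n : ℕ in atTop,
      LipschitzWith (ρ ^ n) (pastIterate (fun k => ψ (ξ k ω)) (n - 1) n) := by
  obtain ⟨r, hr, hneg⟩ := h.exists_negativeLogMean
  have := Measure.isProbabilityMeasure_map (μ := P) h.measurePreserving_path.aemeasurable
  have hL := fun n : ℕ => h.measurable_lipCoeff_pastIterate (n - 1) n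
  have hpath := h.stationary_ergodic.isStationary.measurePreserving_path
  have hneg' : NegativeLogMean P fun ω =>
      lipCoeff (pastIterate (fun k => ψ (ξ (k + (1 - r)) ω)) (r - 1) r) := by
    convert hneg using 3 with ω
    rw [pastIterate_comp_add (fun k => ψ (ξ k ω)), sub_add_sub_cancel', sub_self]
  obtain ⟨ρ, hρ, hev⟩ := (isSubmulCocycle_forward ψ).exists_ae_eventually_le_pow
    h.stationary_ergodic.2 (hL 1)
    ((finiteLogPosMoment_comp_iff h.measurePreserving_path (hL 1)).1 h.logPos_lipCoeff) hr (hL r)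
    ((negativeLogMean_comp_iff (hpath (1 - r)) (hL r)).1 hneg')
  refine ⟨ρ, hρ, ?_⟩
  filter_upwards [h.measurePreserving_path.quasiMeasurePreserving.ae hev] with ω hω
  filter_upwards [hω] with n hn
  rwa [← ENNReal.coe_pow, lipCoeff_le_coe_iff] at hn

theorem ae_eventually_edist_le_pow [SecondCountableTopology E] [OpensMeasurableSpace E]
    (h : IsContractiveSRE P ψ ξ) {x₀ x₁ : E}
    (hx : FiniteLogPosMoment P fun ω => edist (ψ (ξ 0 ω) x₀) x₁) {γ : ℝ≥0} (hγ : 1 < γ) :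
    ∀ᵐ ω ∂P, ∀ t : ℤ, ∀ᶠ n : ℕ in atTop, edist (ψ (ξ (t - n) ω) x₀) x₁ ≤ (γ : ℝ≥0∞) ^ n := by
  have := Measure.isProbabilityMeasure_map (μ := P) h.measurePreserving_path.aemeasurable
  have hY : Measurable fun w : ℤ → F => edist (ψ (w 0) x₀) x₁ :=
    ((h.measurable x₀).comp (measurable_pi_apply 0)).edist measurable_const
  have hev := ((finiteLogPosMoment_comp_iff h.measurePreserving_path hY).1
    hx).ae_eventually_iterate_le_pow (ergodic_shiftBy_neg_one h.stationary_ergodic.2) hY hγ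
  filter_upwards [h.stationary_ergodic.isStationary.ae_forall_shift hev] with ω hω t
  simpa [shiftBy_iterate, shiftBy, neg_add_eq_sub] using hω t

section Solution

variable [BorelSpace E] [SecondCountableTopology E]

theorem ae_cauchySeq_pastIterate (h : IsContractiveSRE P ψ ξ) {x₀ x₁ : E}
    (hx : FiniteLogPosMoment P fun ω => edist (ψ (ξ 0 ω) x₀) x₁) :
    ∀ᵐ ω ∂P, ∀ t : ℤ, CauchySeq fun n => pastIterate (fun k => ψ (ξ k ω)) t n x₀ := by
  obtain ⟨ρ, hρ, hback⟩ := h.exists_ae_lipschitzWith_backward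
  obtain ⟨γ, hγ, hργ⟩ := exists_one_lt_mul_lt_one hρ
  filter_upwards [hback, h.ae_eventually_edist_le_pow hx hγ] with ω hω hxω t
  exact cauchySeq_pastIterate hρ hργ (hω t) (hxω t)

theorem ae_eq_of_isStationary (h : IsContractiveSRE P ψ ξ) {u v : ℤ → Ω → E}
    (hu : IsSRESolution P (fun t ω => ψ (ξ t ω)) u) (hus : IsStationary P u)
    (hv : IsSRESolution P (fun t ω => ψ (ξ t ω)) v) (hvs : IsStationary P v) (t : ℤ) :
    ∀ᵐ ω ∂P, u t ω = v t ω := by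
  obtain ⟨ρ, hρ, hback⟩ := h.exists_ae_lipschitzWith_backward
  exact hu.ae_eq_of_identDistrib hv hus.identDistrib hvs.identDistrib
    (tendsto_pow_atTop_nhds_zero_of_lt_one zero_le hρ) hback t

theorem isSRESolution_backwardLimit [CompleteSpace E] (h : IsContractiveSRE P ψ ξ) {x₀ x₁ : E}
    (hx : FiniteLogPosMoment P fun ω => edist (ψ (ξ 0 ω) x₀) x₁) :
    IsSRESolution P (fun t ω => ψ (ξ t ω))
      fun t ω => backwardLimit (fun k => ψ (ξ k ω)) x₀ t := by
  intro t
  filter_upwards [h.ae_cauchySeq_pastIterate hx] with ω hω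
  exact backwardLimit_add_one (h.continuous _) fun t => hω (t - 1)

end Solution

theorem exists_ae_tendsto_pow_mul_dist [SecondCountableTopology E] [BorelSpace E]
    (h : IsContractiveSRE P ψ ξ) {u : ℤ → Ω → E}
    (hu : IsSRESolution P (fun t ω => ψ (ξ t ω)) u) (x₀ : E) :
    ∃ γ : ℝ, 1 < γ ∧ ∀ᵐ ω ∂P, Tendsto (fun n : ℕ =>
      γ ^ n * dist (pastIterate (fun k => ψ (ξ k ω)) (n - 1) n x₀) (u n ω)) atTop (𝓝 0) := by
  obtain ⟨ρ, hρ, hfwd⟩ := h.exists_ae_lipschitzWith_forward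
  obtain ⟨γ, hγ, hργ⟩ := exists_one_lt_mul_lt_one hρ
  refine ⟨γ, by exact_mod_cast hγ, ?_⟩
  filter_upwards [hfwd, ae_all_iff.2 hu] with ω hω huω
  exact tendsto_pow_mul_dist_pastIterate (s := fun k => u k ω) hργ huω hω

end IsContractiveSRE

end Contractive

section VolMap

variable {d : ℕ} {K : Compacts (EuclideanSpace ℝ (Fin d))} {p q : ℕ}

theorem measurable_volFun_of_eval {W : Type*} {m : MeasurableSpace W} {f : W → VolFun K q}
    (hf : ∀ θ, Measurable fun w => f w θ) : Measurable f := by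
  obtain ⟨S, hSc, hS⟩ := exists_countable_dense K
  have := hSc.to_subtype
  have hcont : Continuous fun (u : VolFun K q) (θ : S) => u θ :=
    continuous_pi fun θ => continuous_eval_const _
  have hinj : Function.Injective fun (u : VolFun K q) (θ : S) => u θ := fun u v huv =>
    DFunLike.coe_injective (u.continuous.ext_on hS v.continuous fun θ hθ => congrFun huv ⟨θ, hθ⟩)
  rw [← (hcont.measurableEmbedding hinj).measurable_comp_iff]
  exact measurable_pi_lambda _ fun θ => hf θ

theorem enorm_toVec (f : VolFun K q) :
    ‖toVec f‖ₑ = edist f (ContinuousMap.const K (WithLp.toLp 2 fun _ => 0)) := by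
  have h0 : toVec (ContinuousMap.const K (WithLp.toLp 2 fun _ : Fin q => (0 : ℝ≥0))) = 0 := by
    ext θ _
    simp [toVec]
  rw [edist_dist, dist_eq_norm_toVec, h0, sub_zero, ofReal_norm]

variable {g : K → (Fin p → ℝ) → Orthant q → ℝ≥0}
  {hg : ∀ x, Continuous fun y : K × Orthant q => g y.1 x y.2}

theorem continuous_volMap (x : Fin p → ℝ) : Continuous (volMap g hg x) := by
  refine ContinuousMap.continuous_of_continuous_uncurry _ ?_
  have heval : Continuous fun y : VolFun K q × K => y.1 y.2 := by fun_prop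
  exact continuous_consShift ((hg x).comp (continuous_snd.prodMk heval)) heval

theorem measurable_volMap (hg_meas : ∀ θ s, Measurable fun x => g θ x s) (s : VolFun K q) :
    Measurable fun x => volMap g hg x s := by
  refine measurable_volFun_of_eval fun θ => ?_
  have hcons : Continuous fun a : ℝ≥0 => consShift a (s θ) :=
    continuous_consShift continuous_id continuous_const
  exact hcons.measurable.comp (hg_meas θ (s θ))

theorem hHat_eq_pastIterate {Ω : Type*} (X : ℤ → Ω → ℝ) (ς : Orthant q) (ω : Ω) (n : ℕ) :
    hHat g hg X ς n ω =
      pastIterate (fun t => Phi g hg X t ω) (n - 1) n (ContinuousMap.const K ς) := by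
  induction n with
  | zero => rfl
  | succ n ih => rw [hHat, ih, pastIterate_succ_apply, Nat.cast_succ, add_sub_cancel_right]

/-- The map `s ↦ (g(x, s), s_1, …, s_{q-1})` of `[0, ∞)^q` which drives the squared volatilities of
the model with volatility function `g`. -/
noncomputable def volStep (gθ : (Fin p → ℝ) → Orthant q → ℝ≥0) (x : Fin p → ℝ) (s : Orthant q) :
    Orthant q :=
  consShift (gθ x s) s

theorem semiconj_eval_volMap (x : Fin p → ℝ) (θ : K) :
    Function.Semiconj (fun f : VolFun K q => f θ) (volMap g hg x) (volStep (g θ) x) :=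
  fun _ => rfl

theorem lipschitzWith_pastIterate_volStep {C : ℝ≥0} {x : ℤ → Fin p → ℝ} {t : ℤ} {n : ℕ}
    (h : LipschitzWith C (pastIterate (fun k => volMap g hg (x k)) t n)) (θ : K) :
    LipschitzWith C (pastIterate (fun k => volStep (g θ) (x k)) t n) := by
  have heval := semiconj_pastIterate (fun k => semiconj_eval_volMap (g := g) (hg := hg) (x k) θ) t n
  refine .of_dist_le_mul fun s s' => ?_
  have hconst : dist (ContinuousMap.const K s) (ContinuousMap.const K s') ≤ dist s s' :=
    (ContinuousMap.dist_le dist_nonneg).2 fun _ => le_rfl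
  have hs : pastIterate (fun k => volStep (g θ) (x k)) t n s = _ :=
    (heval (ContinuousMap.const K s)).symm
  have hs' : pastIterate (fun k => volStep (g θ) (x k)) t n s' = _ :=
    (heval (ContinuousMap.const K s')).symm
  rw [hs, hs']
  exact (ContinuousMap.dist_apply_le_dist θ).trans ((h.dist_le_mul _ _).trans (by gcongr))

end VolMap

section Model

variable {Ω : Type*} {Z : ℤ → Ω → ℝ}

theorem past_mono {s t : ℤ} (h : s ≤ t) : past Z s ≤ past Z t :=
  iSup_mono fun _ => iSup_mono' fun hk => ⟨hk.trans h, le_rfl⟩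

theorem measurable_past {s t : ℤ} (h : s ≤ t) : Measurable[past Z t] (Z s) :=
  (comap_measurable (Z s)).mono (le_iSup_of_le s (le_iSup_of_le h le_rfl)) le_rfl

theorem past_le [MeasurableSpace Ω] (hZ : ∀ t, Measurable (Z t)) (t : ℤ) :
    past Z t ≤ ‹MeasurableSpace Ω› :=
  iSup_le fun k => iSup_le fun _ => (hZ k).comap_le

variable {p q : ℕ} {gθ : (Fin p → ℝ) → Orthant q → ℝ≥0} {X : ℤ → Ω → ℝ} {σ : ℤ → Ω → ℝ≥0}

theorem volVec_add_one {ω : Ω} {t : ℤ}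
    (h : σ (t + 1) ω ^ 2 = gθ (obsVec p X t ω) (volVec q σ t ω)) :
    volVec q σ (t + 1) ω = volStep gθ (obsVec p X t ω) (volVec q σ t ω) := by
  ext i
  rw [volStep, ← h]
  by_cases hi : (i : ℕ) = 0
  · simp [volVec, consShift, hi]
  · have hpred : t + 1 - (i : ℕ) = t - ((i : ℕ) - 1 : ℕ) := by omega
    simp [volVec, consShift, hi, hpred]

variable [MeasurableSpace Ω] {P : Measure Ω}

theorem IsModelSolution.isSRESolution_volVec (h : IsModelSolution P Z gθ X σ) :
    IsSRESolution P (fun t ω => volStep gθ (obsVec p X t ω)) (volVec q σ) := by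
  intro t
  filter_upwards [h.vol_eq (t + 1)] with ω hω
  exact volVec_add_one (by simpa using hω)

theorem IsStationaryErgodic.volVec (h : IsStationaryErgodic P σ) (q : ℕ) :
    IsStationaryErgodic P (volVec q σ) := by
  refine h.factor (G := fun w t => WithLp.toLp 2 fun j : Fin q => w (t - (j : ℕ)) ^ 2) ?_ ?_
  · refine measurable_pi_lambda _ fun t => (WithLp.measurable_toLp 2 _).comp ?_
    exact measurable_pi_lambda _ fun j => (measurable_pi_apply _).pow_const 2
  · intro w
    ext t j
    simp only [shift, sub_add_eq_add_sub]

theorem IsStationaryErgodic.obsVec (h : IsStationaryErgodic P X) (p : ℕ) :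
    IsStationaryErgodic P (obsVec p X) := by
  refine h.factor (G := fun w t (i : Fin p) => w (t - (i : ℕ))) ?_ fun w => ?_
  · exact measurable_pi_lambda _ fun t => measurable_pi_lambda _ fun i => measurable_pi_apply _
  · ext t i
    simp only [shift, sub_add_eq_add_sub]

variable {d : ℕ} {K : Compacts (EuclideanSpace ℝ (Fin d))}
  {g : K → (Fin p → ℝ) → Orthant q → ℝ≥0}
  {hg : ∀ x, Continuous fun y : K × Orthant q => g y.1 x y.2}

theorem IsStationaryErgodic.phi (h : IsStationaryErgodic P X)
    (hg_meas : ∀ θ s, Measurable fun x => g θ x s) : IsStationaryErgodic P (Phi g hg X) :=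
  (h.obsVec p).comp (measurable_pi_lambda (volMap g hg) fun s => measurable_volMap hg_meas s)

theorem IsModelSolution.exists_adapted_ae_eq_backwardLimit (h : IsModelSolution P Z gθ X σ)
    (hg_meas : ∀ θ s, Measurable fun x => g θ x s) (x₀ : VolFun K q) :
    ∃ u : ℤ → Ω → VolFun K q, (∀ t, Measurable[past Z (t - 1)] (u t)) ∧
      ∀ᵐ ω ∂P, ∀ t, u t ω = backwardLimit (fun k => Phi g hg X k ω) x₀ t := by
  let X' : ℤ → Ω → ℝ := fun k ω => σ k ω * Z k ω
  have hX' {s t : ℤ} (hst : s ≤ t) : Measurable[past Z t] (X' s) :=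
    ((h.adapted s).mono (past_mono (by omega)) le_rfl).coe_nnreal_real.mul (measurable_past hst)
  refine ⟨fun t ω => backwardLimit (fun k => Phi g hg X' k ω) x₀ t, fun t => ?_, ?_⟩
  · refine measurable_backwardLimit (fun k ω => continuous_volMap _) x₀ fun k hk s => ?_
    exact (measurable_volMap (hg := hg) hg_meas s).comp
      (@measurable_pi_lambda _ _ _ (past Z (t - 1)) _ _ fun i => hX' (by omega))
  · filter_upwards [ae_all_iff.2 h.obs_eq] with ω hω t
    have hXω : ∀ k, obsVec p X' k ω = obsVec p X k ω := fun k => funext fun i => (hω _).symm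
    simp only [Phi, hXω]

variable [IsProbabilityMeasure P]

theorem IsContractiveSRE.ae_apply_eq_volVec
    (hΦ : IsContractiveSRE P (volMap g hg) (obsVec p X)) {θ : K}
    (hσ : IsModelSolution P Z (g θ) X σ) (hσs : IsStationary P (volVec q σ))
    {u : ℤ → Ω → VolFun K q} (hu : IsSRESolution P (Phi g hg X) u)
    (hus : IsStationary P u) (t : ℤ) : ∀ᵐ ω ∂P, u t ω θ = volVec q σ t ω := by
  obtain ⟨ρ, hρ, hback⟩ := hΦ.exists_ae_lipschitzWith_backward
  have huθ : IsSRESolution P (fun t ω => volStep (g θ) (obsVec p X t ω))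
      fun t ω => u t ω θ :=
    fun t => (hu t).mono fun ω hω => congrArg (fun f : VolFun K q => f θ) hω
  refine huθ.ae_eq_of_identDistrib hσ.isSRESolution_volVec
    (fun t => (hus.identDistrib t).comp (continuous_eval_const θ).measurable) hσs.identDistrib
    (tendsto_pow_atTop_nhds_zero_of_lt_one zero_le hρ) ?_ t
  filter_upwards [hback] with ω hω t
  filter_upwards [hω t] with n hn
  exact lipschitzWith_pastIterate_volStep hn θ

end Model

end CondHet

open CondHet in
theorem proposition3p12_general
    {Ω : Type*} [MeasurableSpace Ω] (P : Measure Ω) [IsProbabilityMeasure P]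
    (p q d : ℕ) (K : Compacts (EuclideanSpace ℝ (Fin d))) (θ₀ : K)
    (Z : ℤ → Ω → ℝ) (hZ : ∀ t, Measurable (Z t))
    (g : K → (Fin p → ℝ) → Orthant q → ℝ≥0)
    (hg_meas : ∀ θ s, Measurable fun x => g θ x s)
    (hg : ∀ x, Continuous fun y : K × Orthant q => g y.1 x y.2)
    (X : ℤ → Ω → ℝ) (σ : ℤ → Ω → ℝ≥0) (hXσ : IsModelSolution P Z (g θ₀) X σ)
    (hse : IsStationaryErgodic P fun t ω => (X t ω, σ t ω)) :
    IsStationaryErgodic P (Phi g hg X) ∧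
    ∀ ς : Orthant q,
      FiniteLogPosMoment P (fun ω => ‖toVec (Phi g hg X 0 ω (ContinuousMap.const K ς))‖ₑ) →
      FiniteLogPosMoment P (fun ω => lipCoeff (Phi g hg X 0 ω)) →
      (∃ r : ℕ, 1 ≤ r ∧ NegativeLogMean P (fun ω =>
        lipCoeff (pastIterate (fun t => Phi g hg X t ω) 0 r))) →
      ∃ h : ℤ → Ω → VolFun K q,
        IsSRESolution P (Phi g hg X) h ∧
        IsStationaryErgodic P h ∧
        (∀ h' : ℤ → Ω → VolFun K q, IsSRESolution P (Phi g hg X) h' → IsStationary P h' →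
          ∀ t, ∀ᵐ ω ∂P, h' t ω = h t ω) ∧
        (∀ t, Measurable[past Z (t - 1)] (h t)) ∧
        (∀ t, ∀ᵐ ω ∂P, h t ω θ₀ = volVec q σ t ω) ∧
        TendstoZeroEAS P fun (t : ℕ) ω => toVec (hHat g hg X ς t ω) - toVec (h t ω) := by
  have hX : IsStationaryErgodic P X := hse.comp measurable_fst
  have hσ : IsStationaryErgodic P σ := hse.comp measurable_snd
  refine ⟨hX.phi hg_meas, fun ς hmoment hpos hneg => ?_⟩
  have hΦ : IsContractiveSRE P (volMap g hg) (obsVec p X) :=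
    ⟨hX.obsVec p, continuous_volMap, measurable_volMap hg_meas, hpos, hneg⟩
  simp only [enorm_toVec] at hmoment
  obtain ⟨h, hadapted, hlim⟩ :=
    hXσ.exists_adapted_ae_eq_backwardLimit hg_meas (ContinuousMap.const K ς)
  have hsre : IsSRESolution P (Phi g hg X) h :=
    (hΦ.isSRESolution_backwardLimit hmoment).congr_ae hlim
  have hstat : IsStationaryErgodic P h := (hΦ.isStationaryErgodic_backwardLimit _).congr_ae
    (fun t => (hadapted t).mono (past_le hZ _) le_rfl) hlim
  obtain ⟨γ, hγ, hconv⟩ := hΦ.exists_ae_tendsto_pow_mul_dist hsre (ContinuousMap.const K ς)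
  refine ⟨h, hsre, hstat, fun h' hsre' hstat' t => ?_, hadapted, ?_, γ, hγ, ?_⟩
  · exact hΦ.ae_eq_of_isStationary hsre' hstat' hsre hstat.isStationary t
  · exact hΦ.ae_apply_eq_volVec hXσ (hσ.volVec q).isStationary hsre hstat.isStationary
  · simp_rw [hHat_eq_pastIterate, ← dist_eq_norm_toVec]
    exact hconv

theorem proposition3p12
    {Ω : Type*} [MeasurableSpace Ω] (P : Measure Ω) [IsProbabilityMeasure P]
    (p q d : ℕ) (K : Compacts (EuclideanSpace ℝ (Fin d))) (θ₀ : K)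
    (Z : ℤ → Ω → ℝ) (hZ : CondHet.IsInnovation P Z)
    (g : K → (Fin p → ℝ) → CondHet.Orthant q → ℝ≥0)
    (hg_meas : ∀ θ s, Measurable fun x => g θ x s)
    (hg : ∀ x, Continuous fun y : K × CondHet.Orthant q => g y.1 x y.2)
    (X : ℤ → Ω → ℝ) (σ : ℤ → Ω → ℝ≥0)
    (hXσ : CondHet.IsUniqueStationaryErgodicSolution P Z (g θ₀) X σ) :
    -- `(Φ_t)` is stationary ergodic, with the σ-field generated by the evaluations on the maps
    CondHet.IsStationaryErgodic P (CondHet.Phi g hg X) ∧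
    ∀ ς : CondHet.Orthant q,
      CondHet.FiniteLogPosMoment P
        (fun ω => ‖CondHet.toVec (CondHet.Phi g hg X 0 ω (ContinuousMap.const K ς))‖ₑ) →
      CondHet.FiniteLogPosMoment P (fun ω => CondHet.lipCoeff (CondHet.Phi g hg X 0 ω)) →
      (∃ r : ℕ, 1 ≤ r ∧ CondHet.NegativeLogMean P (fun ω =>
        CondHet.lipCoeff (CondHet.pastIterate (fun t => CondHet.Phi g hg X t ω) 0 r))) →
      ∃ h : ℤ → Ω → CondHet.VolFun K q,
        CondHet.IsSRESolution P (CondHet.Phi g hg X) h ∧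
        CondHet.IsStationaryErgodic P h ∧
        (∀ h' : ℤ → Ω → CondHet.VolFun K q,
          CondHet.IsSRESolution P (CondHet.Phi g hg X) h' → CondHet.IsStationary P h' →
            ∀ t, ∀ᵐ ω ∂P, h' t ω = h t ω) ∧
        (∀ t, Measurable[CondHet.past Z (t - 1)] (h t)) ∧
        (∀ t, ∀ᵐ ω ∂P, h t ω θ₀ = CondHet.volVec q σ t ω) ∧
        CondHet.TendstoZeroEAS P (fun (t : ℕ) ω =>
          CondHet.toVec (CondHet.hHat g hg X ς t ω) - CondHet.toVec (h t ω)) :=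
  proposition3p12_general P p q d K θ₀ Z hZ.measurable g hg_meas hg X σ hXσ.solution
    hXσ.stationary_ergodic
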